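/- Let $A,Z,M\ge 1$ be integers, let $\mathcal A$ be a set of $A$ actions and $\mathcal Z$ a set of $Z$ reward values, and write vectors of $\mathbb R^{AZ}$ as functions $\mu(a,z)$ of $(a,z)\in\mathcal A\times\mathcal Z$. There is a single algorithm (a real RAM program, with unit-cost exact real arithmetic and comparisons, which does not depend on $A,Z,M$) with the following property. Let $\mu_1,\dots,\mu_M\in\mathbb R^{AZ}$ and $\mathbf U=\mathrm{span}\{\mu_1,\dots,\mu_M\}$. Given $A,Z,M$ and the subspace $\mathbf U$ in the form of any vectors $b_1,\dots,b_M\in\mathbb R^{AZ}$ with $\mathrm{span}\{b_1,\dots,b_M\}=\mathbf U$, the algorithm halts after $\tilde O(ZAM^2)$ steps, that is, after at most $C\cdot ZAM^2\,(1+\log(ZAM^2))^{c}$ steps with absolute constants $C,c$, and returns 1. distinct core action-value pairs $(a_1,z_1),\dots,(a_n,z_n)\in\mathcal A\times\mathcal Z$ with $n\le 4M\log\log M+16$ (natural logarithms; for $M=1$ the term $4M\log\log M$ is read as $0$), such that for every $m\in\{1,\dots,M\}$ and every $\hat\mu\in\mathbf U$ $$\max_{a\in\mathcal A}\ \sum_{z\in\mathcal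 Z}|\mu_m(a,z)-\hat\mu(a,z)|\ \le\ 2Z\sqrt{2M}\cdot\max_{1\le j\le n}|\nu_m(j)-\hat\nu(j)|,$$ where $\nu_m(j)=\mu_m(a_j,z_j)$ and $\hat\nu(j)=\hat\mu(a_j,z_j)$ (a maximum over the empty set, which can occur only for $\mathbf U=0$, is $0$); 2. a matrix $T\in\mathbb R^{AZ\times n}$ with $T\hat\nu=\hat\mu$ for every $\hat\mu\in\mathbf U$, where $\hat\nu(j)=\hat\mu(a_j,z_j)$. -/

import Mathlib

/-! A real RAM: a small imperative language over memory that holds natural numbers and exact reals,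
with unit-cost arithmetic, comparisons and indexed memory access, and a step-counting semantics.
Reals can be used only through field operations and comparisons: there is no rounding, and no way
from reals to natural numbers except branching. -/

namespace RealRAM

/-- The memory: natural-number and real variables, and natural-number and real arrays with two
subscripts. Variables and arrays are named by natural numbers. -/
structure State where
  nat : ℕ → ℕ
  real : ℕ → ℝ
  natArr : ℕ → ℕ → ℕ → ℕ
  realArr : ℕ → ℕ → ℕ → ℝ

/-- Natural-number expressions (`sub` is truncated subtraction). -/
inductive NExpr where
  | lit (n : ℕ)
  | var (x : ℕ)
  | arr (x : ℕ) (i j : NExpr)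
  | add (e f : NExpr)
  | sub (e f : NExpr)
  | mul (e f : NExpr)

/-- Real expressions. The only constants are natural numbers. -/
inductive RExpr where
  | ofNat (e : NExpr)
  | var (x : ℕ)
  | arr (x : ℕ) (i j : NExpr)
  | add (e f : RExpr)
  | sub (e f : RExpr)
  | mul (e f : RExpr)
  | div (e f : RExpr)

/-- Tests. -/
inductive BExpr where
  | natLt (e f : NExpr)
  | realLt (e f : RExpr)
  | not (b : BExpr)
  | and (b c : BExpr)

/-- Programs. -/
inductive Prog where
  | skip
  | setNat (x : ℕ) (e : NExpr)
  | setReal (x : ℕ) (e : RExpr)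
  | storeNat (x : ℕ) (i j : NExpr) (e : NExpr)
  | storeReal (x : ℕ) (i j : NExpr) (e : RExpr)
  | seq (p q : Prog)
  | ite (b : BExpr) (p q : Prog)
  | loop (b : BExpr) (p : Prog)

/-- The value of a natural-number expression. -/
def NExpr.eval (s : State) : NExpr → ℕ
  | .lit n => n
  | .var x => s.nat x
  | .arr x i j => s.natArr x (i.eval s) (j.eval s)
  | .add e f => e.eval s + f.eval s
  | .sub e f => e.eval s - f.eval s
  | .mul e f => e.eval s * f.eval s

/-- The number of operations needed to evaluate a natural-number expression. -/
def NExpr.cost : NExpr → ℕ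
  | .lit _ => 1
  | .var _ => 1
  | .arr _ i j => 1 + i.cost + j.cost
  | .add e f => 1 + e.cost + f.cost
  | .sub e f => 1 + e.cost + f.cost
  | .mul e f => 1 + e.cost + f.cost

/-- The value of a real expression (a division by zero returns zero). -/
noncomputable def RExpr.eval (s : State) : RExpr → ℝ
  | .ofNat e => (e.eval s : ℝ)
  | .var x => s.real x
  | .arr x i j => s.realArr x (i.eval s) (j.eval s)
  | .add e f => e.eval s + f.eval s
  | .sub e f => e.eval s - f.eval s
  | .mul e f => e.eval s * f.eval s
  | .div e f => e.eval s / f.eval s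

/-- The number of operations needed to evaluate a real expression. -/
def RExpr.cost : RExpr → ℕ
  | .ofNat e => 1 + e.cost
  | .var _ => 1
  | .arr _ i j => 1 + i.cost + j.cost
  | .add e f => 1 + e.cost + f.cost
  | .sub e f => 1 + e.cost + f.cost
  | .mul e f => 1 + e.cost + f.cost
  | .div e f => 1 + e.cost + f.cost

/-- The truth value of a test. -/
def BExpr.holds (s : State) : BExpr → Prop
  | .natLt e f => e.eval s < f.eval s
  | .realLt e f => e.eval s < f.eval s
  | .not b => ¬ b.holds s
  | .and b c => b.holds s ∧ c.holds s

/-- The number of operations needed to evaluate a test. -/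
def BExpr.cost : BExpr → ℕ
  | .natLt e f => 1 + e.cost + f.cost
  | .realLt e f => 1 + e.cost + f.cost
  | .not b => 1 + b.cost
  | .and b c => 1 + b.cost + c.cost

/-- Overwrite a natural-number variable. -/
def State.setNat (s : State) (x v : ℕ) : State :=
  { s with nat := Function.update s.nat x v }

/-- Overwrite a real variable. -/
noncomputable def State.setReal (s : State) (x : ℕ) (v : ℝ) : State :=
  { s with real := Function.update s.real x v }

/-- Overwrite one entry of a natural-number array. -/
def State.storeNat (s : State) (x i j v : ℕ) : State :=
  { s with natArr := fun x' i' j' =>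
      if x' = x ∧ i' = i ∧ j' = j then v else s.natArr x' i' j' }

/-- Overwrite one entry of a real array. -/
noncomputable def State.storeReal (s : State) (x i j : ℕ) (v : ℝ) : State :=
  { s with realArr := fun x' i' j' =>
      if x' = x ∧ i' = i ∧ j' = j then v else s.realArr x' i' j' }

/-- `Runs p s s' t`: started in memory `s`, the program `p` halts in memory `s'` after exactly `t`
elementary operations. -/
inductive Runs : Prog → State → State → ℕ → Prop where
  | skip (s : State) : Runs .skip s s 1
  | setNat (x : ℕ) (e : NExpr) (s : State) :
      Runs (.setNat x e) s (s.setNat x (e.eval s)) (1 + e.cost)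
  | setReal (x : ℕ) (e : RExpr) (s : State) :
      Runs (.setReal x e) s (s.setReal x (e.eval s)) (1 + e.cost)
  | storeNat (x : ℕ) (i j e : NExpr) (s : State) :
      Runs (.storeNat x i j e) s (s.storeNat x (i.eval s) (j.eval s) (e.eval s))
        (1 + i.cost + j.cost + e.cost)
  | storeReal (x : ℕ) (i j : NExpr) (e : RExpr) (s : State) :
      Runs (.storeReal x i j e) s (s.storeReal x (i.eval s) (j.eval s) (e.eval s))
        (1 + i.cost + j.cost + e.cost)
  | seq {p q : Prog} {s s' s'' : State} {t t' : ℕ} :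
      Runs p s s' t → Runs q s' s'' t' → Runs (.seq p q) s s'' (t + t')
  | ite_true {b : BExpr} {p q : Prog} {s s' : State} {t : ℕ} :
      b.holds s → Runs p s s' t → Runs (.ite b p q) s s' (1 + b.cost + t)
  | ite_false {b : BExpr} {p q : Prog} {s s' : State} {t : ℕ} :
      ¬ b.holds s → Runs q s s' t → Runs (.ite b p q) s s' (1 + b.cost + t)
  | loop_true {b : BExpr} {p : Prog} {s s' s'' : State} {t t' : ℕ} :
      b.holds s → Runs p s s' t → Runs (.loop b p) s' s'' t' →
        Runs (.loop b p) s s'' (1 + b.cost + t + t')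
  | loop_false {b : BExpr} {p : Prog} {s : State} :
      ¬ b.holds s → Runs (.loop b p) s s (1 + b.cost)

end RealRAM

/-- The initial memory for `A` actions, `Z` reward values and vectors `b 1, …, b M` indexed by
action-value pairs: the variables `0, 1, 2` hold `A, Z, M`, the entry `b m (a, z)` stands at
`[a * Z + z, m]` in the real array `0`, and everything else is zero. -/
noncomputable def inputState (A Z M : ℕ) (b : Fin M → Fin A × Fin Z → ℝ) : RealRAM.State where
  nat x := if x = 0 then A else if x = 1 then Z else if x = 2 then M else 0
  real _ := 0
  natArr _ _ _ := 0
  realArr x i m :=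
    if h : x = 0 ∧ i < A * Z ∧ m < M then b ⟨m, h.2.2⟩ (finProdFinEquiv.symm ⟨i, h.2.1⟩) else 0

/-- The memory `s` contains the list of pairs `core` and the matrix `T`: the variable `0` holds the
length `n`, the `j`-th pair stands at `[j, 0]`, `[j, 1]` in the natural-number array `0`, and the
entry `T (a, z) j` stands at `[a * Z + z, j]` in the real array `1`. -/
def HasOutput {A Z n : ℕ} (s : RealRAM.State) (core : Fin n → Fin A × Fin Z)
    (T : Matrix (Fin A × Fin Z) (Fin n) ℝ) : Prop :=
  s.nat 0 = n ∧
  (∀ j : Fin n, s.natArr 0 j 0 = (core j).1 ∧ s.natArr 0 j 1 = (core j).2) ∧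
  ∀ (a : Fin A) (z : Fin Z) (j : Fin n), s.realArr 1 (a * Z + z) j = T (a, z) j

/-! The idea is to choose the core pairs as the support of a nearly D-optimal (equivalently, nearly
G-optimal) experimental design on the rows of a basis matrix of `U`. Put `d = dim U`. If row `q` has
coordinates `x q`, a design `w` has Gram matrix `H = ∑ w q • x q (x q)ᵀ`, total weight `W` and
leverages `x q ⬝ᵥ H⁻¹ x q`. Any `u ∈ U` has the form `u q = θ ⬝ᵥ x q`, and Cauchy–Schwarz gives
`u(q)² ≤ leverage(q) · W · max u²` over the support (`dotProduct_sq_le_of_abs_le`). Once every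
leverage is at most `8d / W`, this bounds `|u|` by `2√(2M)` times its maximum on the core pairs.
Summing over the `Z` reward values gives the claim.

Gaussian elimination, always pivoting on an entry of largest modulus, finds a basis dual to
evaluation at `d` pivots. It also shows that a matrix of determinant one maps every `x q` to a
vector with entries in `[-1, 1]` (`PivotBasis.exists_unimodular`). By AM–GM every normalized design
has log-determinant at most `0`, so the uniform design on the pivots is within `d log d` of the
optimum (`designGap_unitDesign_le`).

From there, weight `W / d` is repeatedly added to the row of maximal leverage. While some leverage
exceeds `8d / W`, the gap `D` to the optimal log-determinant falls by at least `max 1 (D / d - 1)`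
(`designGap_add_single`). Hence `D / d - 1` decays geometrically until `D ≤ 2d`, and at most `2d`
further steps remain. Starting from `D = d log d` this takes about `d log log d + 2d` steps
(`stepBound_add_one_le`, `add_stepBound_le`), each adding at most one core pair.

The vectors `H⁻¹ x q` are maintained by rank-one updates in `O(AZd)` operations per step, so the
running time is dominated by `O(ZAM²)` up to a logarithm (`coreProgram_cost_le`). The matrix `T` is
the dual basis, padded with zero columns at the core pairs that are not pivots. -/

section Design

/-! ### Optimal design: determinants, leverages and the greedy step. -/

set_option linter.unusedSectionVars false

open Matrix

variable {ι : Type*} [Fintype ι] {d : ℕ}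

/-- The weighted Gram matrix `∑ i, w i • x i (x i)ᵀ`. -/
def designGram (x : ι → Fin d → ℝ) (w : ι → ℝ) : Matrix (Fin d) (Fin d) ℝ :=
  ∑ i, w i • vecMulVec (x i) (x i)

theorem posSemidef_smul_vecMulVec {c : ℝ} (hc : 0 ≤ c) (u : Fin d → ℝ) :
    (c • vecMulVec u u).PosSemidef := by
  have := posSemidef_vecMulVec_self_star u
  rw [star_trivial] at this
  exact this.smul hc

theorem designGram_posSemidef (x : ι → Fin d → ℝ) {w : ι → ℝ} (hw : ∀ i, 0 ≤ w i) :
    (designGram x w).PosSemidef :=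
  posSemidef_sum _ fun i _ => posSemidef_smul_vecMulVec (hw i) (x i)

theorem designGram_transpose (x : ι → Fin d → ℝ) (w : ι → ℝ) :
    (designGram x w)ᵀ = designGram x w := by
  simp [designGram, transpose_sum, transpose_smul, transpose_vecMulVec]

/-- AM–GM for the eigenvalues. -/
theorem det_le_trace_div_pow (hd : 0 < d) {H : Matrix (Fin d) (Fin d) ℝ} (hH : H.PosSemidef) :
    H.det ≤ (H.trace / d) ^ d := by
  have h0 := hH.eigenvalues_nonneg
  have hdet := hH.1.det_eq_prod_eigenvalues
  have htr := hH.1.trace_eq_sum_eigenvalues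
  simp only [RCLike.ofReal_real_eq_id, id_eq] at hdet htr
  have hd' : (d : ℝ) ≠ 0 := by positivity
  have := Real.geom_mean_le_arith_mean_weighted Finset.univ (fun _ : Fin d => (d : ℝ)⁻¹)
    hH.1.eigenvalues (fun _ _ => by positivity) (by simp [hd']) (fun i _ => h0 i)
  rw [Real.finsetProd_rpow _ _ (fun i _ => h0 i), ← hdet, ← Finset.mul_sum, ← htr] at this
  have hdet0 : 0 ≤ H.det := hdet ▸ Finset.prod_nonneg fun i _ => h0 i
  calc H.det = (H.det ^ (d : ℝ)⁻¹) ^ d := by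
        rw [Real.rpow_inv_natCast_pow hdet0 hd.ne']
    _ ≤ _ := by
        rw [div_eq_inv_mul]
        exact pow_le_pow_left₀ (by positivity) this d

theorem mul_designGram_mul_transpose (C : Matrix (Fin d) (Fin d) ℝ) (x : ι → Fin d → ℝ)
    (w : ι → ℝ) :
    C * designGram x w * Cᵀ = designGram (fun i => C *ᵥ x i) w := by
  simp only [designGram, Finset.mul_sum, Finset.sum_mul, mul_smul_comm, smul_mul_assoc,
    mul_vecMulVec, vecMulVec_mul, vecMul_transpose]

theorem trace_designGram (x : ι → Fin d → ℝ) (w : ι → ℝ) :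
    (designGram x w).trace = ∑ i, w i * (x i ⬝ᵥ x i) := by
  simp [designGram, trace_sum, trace_smul, trace_vecMulVec]

/-- Conjugating by `C` gives the Gram matrix of the vectors `C *ᵥ x i`, whose trace is at most `κ *
∑ w`; then AM–GM applies. It serves twice: with a unimodular `C` to bound all designs, and with `Cᵀ
* C = H⁻¹` to bound the gap of one design by its leverages. -/
theorem sq_det_mul_det_designGram_le (hd : 0 < d) (C : Matrix (Fin d) (Fin d) ℝ)
    (x : ι → Fin d → ℝ) {w : ι → ℝ} (hw : ∀ i, 0 ≤ w i) {κ : ℝ}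
    (hκ : ∀ i, (C *ᵥ x i) ⬝ᵥ (C *ᵥ x i) ≤ κ) :
    C.det ^ 2 * (designGram x w).det ≤ (κ * (∑ i, w i) / d) ^ d := by
  have h := det_le_trace_div_pow hd (designGram_posSemidef (fun i => C *ᵥ x i) hw)
  have hnn : 0 ≤ (designGram (fun i => C *ᵥ x i) w).trace :=
    (designGram_posSemidef _ hw).trace_nonneg
  rw [← mul_designGram_mul_transpose, det_mul, det_mul, det_transpose,
    mul_designGram_mul_transpose] at h
  calc _ = C.det * (designGram x w).det * C.det := by ring
    _ ≤ _ := h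
    _ ≤ _ := by
      refine pow_le_pow_left₀ (by positivity) ?_ d
      gcongr
      rw [trace_designGram, Finset.mul_sum]
      refine Finset.sum_le_sum fun i _ => ?_
      rw [mul_comm]
      exact mul_le_mul_of_nonneg_right (hκ i) (hw i)

theorem designGram_add_single [DecidableEq ι] (x : ι → Fin d → ℝ) (w : ι → ℝ) (p : ι) (c : ℝ) :
    designGram x (fun i => w i + if i = p then c else 0) =
      designGram x w + c • vecMulVec (x p) (x p) := by
  simp [designGram, add_smul, Finset.sum_add_distrib, ite_smul]

/-- The matrix determinant lemma. A solution of `H v = u` lets `H` be factored out without inverting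
it. -/
theorem det_add_smul_vecMulVec (H : Matrix (Fin d) (Fin d) ℝ) (u v : Fin d → ℝ) (c : ℝ)
    (h : H *ᵥ v = u) :
    (H + c • vecMulVec u u).det = H.det * (1 + c * (u ⬝ᵥ v)) := by
  have : H + c • vecMulVec u u
      = H * (1 + replicateCol Unit (c • v) * replicateRow Unit u) := by
    rw [mul_add, mul_one, ← vecMulVec_eq, mul_vecMulVec, mulVec_smul, h, smul_vecMulVec]
  rw [this, det_mul, det_one_add_replicateCol_mul_replicateRow, dotProduct_smul, smul_eq_mul]

/-- The rank-one update formula for the solutions of `H v = x`. -/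
theorem designGram_update_mulVec (H : Matrix (Fin d) (Fin d) ℝ) (hH : Hᵀ = H) (u v x y : Fin d → ℝ)
    (c : ℝ) (hv : H *ᵥ v = u) (hy : H *ᵥ y = x) (hc : 1 + c * (u ⬝ᵥ v) ≠ 0) :
    (H + c • vecMulVec u u) *ᵥ (y - (x ⬝ᵥ v * (c / (1 + c * (u ⬝ᵥ v)))) • v) = x := by
  -- Symmetry of `H`: the update coefficient can be read off from `x ⬝ᵥ v`, with `v` the one
  -- solution for the row receiving weight.
  have hs : u ⬝ᵥ y = x ⬝ᵥ v := by
    rw [← hv, ← hy, dotProduct_comm, dotProduct_mulVec, ← mulVec_transpose, hH]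
  have h1 : ∀ z, (c • vecMulVec u u) *ᵥ z = (c * (u ⬝ᵥ z)) • u := by
    intro z
    rw [smul_mulVec, vecMulVec_mulVec, op_smul_eq_smul, smul_smul]
  rw [add_mulVec, h1, mulVec_sub, mulVec_smul, hv, hy, dotProduct_sub, dotProduct_smul, hs]
  ext i
  simp only [Pi.add_apply, Pi.sub_apply, Pi.smul_apply, smul_eq_mul]
  field_simp
  ring

open scoped MatrixOrder Matrix.Norms.L2Operator in
theorem exists_transpose_mul_self_eq {H : Matrix (Fin d) (Fin d) ℝ} (hH : H.PosSemidef) :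
    ∃ C : Matrix (Fin d) (Fin d) ℝ, H = Cᵀ * C := by
  obtain ⟨C, hC⟩ := CStarAlgebra.nonneg_iff_eq_star_mul_self.mp hH.nonneg
  exact ⟨C, by rw [hC, star_eq_conjTranspose, conjTranspose_eq_transpose_of_trivial]⟩

/-- Weak duality between D- and G-optimality. For `Cᵀ * C = H⁻¹` the squared norm of `C *ᵥ x i` is
the leverage `x i ⬝ᵥ V i`, and `C.det ^ 2` is the inverse of the determinant of `H`. -/
theorem det_designGram_le_of_mulVec (hd : 0 < d) (x V : ι → Fin d → ℝ) {w w' : ι → ℝ}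
    (hw' : ∀ i, 0 ≤ w' i) (hpos : (designGram x w).PosDef) (hV : ∀ i, designGram x w *ᵥ V i = x i)
    {κ : ℝ} (hκ : ∀ i, x i ⬝ᵥ V i ≤ κ) :
    (designGram x w').det ≤ (designGram x w).det * (κ * (∑ i, w' i) / d) ^ d := by
  obtain ⟨C, hC⟩ := exists_transpose_mul_self_eq hpos.inv.posSemidef
  have hu : IsUnit (designGram x w).det := (isUnit_iff_isUnit_det _).1 hpos.isUnit
  have hV' : ∀ i, V i = (designGram x w)⁻¹ *ᵥ x i := fun i => by
    rw [← hV i, mulVec_mulVec, nonsing_inv_mul _ hu, one_mulVec]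
  have h := sq_det_mul_det_designGram_le hd C x hw' (κ := κ) (fun i => by
    rw [dotProduct_mulVec, ← mulVec_transpose, mulVec_mulVec, ← hC, ← hV', dotProduct_comm]
    exact hκ i)
  have hdet : C.det ^ 2 * (designGram x w).det = 1 := by
    rw [sq]
    nth_rewrite 1 [← det_transpose C]
    rw [← det_mul, ← hC, ← det_mul, nonsing_inv_mul _ hu, det_one]
  calc (designGram x w').det = (designGram x w).det * (C.det ^ 2 * (designGram x w').det) := by
        linear_combination (-(designGram x w').det) * hdet
    _ ≤ _ := mul_le_mul_of_nonneg_left h hpos.det_pos.le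

/-- The logarithm of the determinant of the normalized design. -/
noncomputable def designPotential (x : ι → Fin d → ℝ) (w : ι → ℝ) : ℝ :=
  Real.log (designGram x w).det - d * Real.log (∑ i, w i)

/-- The values of `designPotential` at the nondegenerate designs. -/
def designPotentials (x : ι → Fin d → ℝ) : Set ℝ :=
  {r | ∃ w : ι → ℝ, (∀ i, 0 ≤ w i) ∧ 0 < (designGram x w).det ∧ 0 < ∑ i, w i ∧
    designPotential x w = r}

/-- How far the design is from being optimal. -/
noncomputable def designGap (x : ι → Fin d → ℝ) (w : ι → ℝ) : ℝ :=
  sSup (designPotentials x) - designPotential x w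

theorem designPotential_nonpos (hd : 0 < d) (C : Matrix (Fin d) (Fin d) ℝ) (hC : C.det = 1)
    (x : ι → Fin d → ℝ) (hx : ∀ i, (C *ᵥ x i) ⬝ᵥ (C *ᵥ x i) ≤ d) {w : ι → ℝ}
    (hw : ∀ i, 0 ≤ w i) (hdet : 0 < (designGram x w).det) :
    designPotential x w ≤ 0 := by
  have h := sq_det_mul_det_designGram_le hd C x hw hx
  have hd' : (d : ℝ) ≠ 0 := by positivity
  rw [hC, one_pow, one_mul, mul_div_cancel_left₀ _ hd'] at h
  have := Real.log_le_log hdet h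
  rw [Real.log_pow] at this
  exact sub_nonpos.2 this

theorem designPotential_le_add (hd : 0 < d) (x V : ι → Fin d → ℝ) {w w' : ι → ℝ}
    (hw' : ∀ i, 0 ≤ w' i) (hdet : 0 < (designGram x w').det) (hW : 0 < ∑ i, w i)
    (hW' : 0 < ∑ i, w' i) (hpos : (designGram x w).PosDef)
    (hV : ∀ i, designGram x w *ᵥ V i = x i) {κ : ℝ} (hκ0 : 0 < κ) (hκ : ∀ i, x i ⬝ᵥ V i ≤ κ) :
    designPotential x w' ≤ designPotential x w + d * Real.log (κ * (∑ i, w i) / d) := by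
  have h := Real.log_le_log hdet (det_designGram_le_of_mulVec hd x V hw' hpos hV hκ)
  have hd' : (0 : ℝ) < d := by positivity
  rw [Real.log_mul hpos.det_pos.ne' (by positivity), Real.log_pow,
    Real.log_div (by positivity) (by positivity), Real.log_mul (by positivity) (by positivity)] at h
  rw [designPotential, designPotential, Real.log_div (by positivity) (by positivity),
    Real.log_mul (by positivity) (by positivity)]
  linarith

/-- Added weight `W / d` multiplies the determinant by one plus leverage times `W / d`. The total
weight grows by the factor `1 + 1 / d`, which costs `d * log (1 + 1 / d) ≤ 1`. -/
theorem designPotential_add_single [DecidableEq ι] (hd : 0 < d) (x V : ι → Fin d → ℝ) {w : ι → ℝ}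
    (hW : 0 < ∑ i, w i) (hpos : (designGram x w).PosDef) (p : ι)
    (hV : designGram x w *ᵥ V p = x p) (hlev : 0 ≤ x p ⬝ᵥ V p) :
    designPotential x w + Real.log (1 + (x p ⬝ᵥ V p) * (∑ i, w i) / d) - 1 ≤
      designPotential x (fun i => w i + if i = p then (∑ i, w i) / d else 0) := by
  have hd' : (0 : ℝ) < d := by positivity
  have h1 : Real.log (∑ i, w i + (∑ i, w i) / d) ≤ Real.log (∑ i, w i) + 1 / d := by
    have : ∑ i, w i + (∑ i, w i) / d = (∑ i, w i) * (1 + 1 / d) := by field_simp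
    rw [this, Real.log_mul (by positivity) (by positivity)]
    linarith [Real.log_le_sub_one_of_pos (show (0 : ℝ) < 1 + 1 / d by positivity)]
  have h2 : (d : ℝ) * Real.log (∑ i, w i + (∑ i, w i) / d) ≤ d * Real.log (∑ i, w i) + 1 := by
    calc _ ≤ (d : ℝ) * (Real.log (∑ i, w i) + 1 / d) := by gcongr
      _ = _ := by field_simp
  rw [designPotential, designPotential, designGram_add_single, det_add_smul_vecMulVec _ _ _ _ hV,
    Finset.sum_add_distrib, Finset.sum_ite_eq' Finset.univ p, if_pos (Finset.mem_univ p),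
    Real.log_mul hpos.det_pos.ne' (by positivity)]
  have h3 : (x p ⬝ᵥ V p) * (∑ i, w i) / d = (∑ i, w i) / d * (x p ⬝ᵥ V p) := by ring
  rw [h3]
  linarith

theorem designGap_nonneg (x : ι → Fin d → ℝ) (hB : BddAbove (designPotentials x)) {w : ι → ℝ}
    (hw : ∀ i, 0 ≤ w i) (hW : 0 < ∑ i, w i) (hpos : (designGram x w).PosDef) :
    0 ≤ designGap x w :=
  sub_nonneg.2 (le_csSup hB ⟨w, hw, hpos.det_pos, hW, rfl⟩)

/-- With `q` the maximal leverage times `W / d`, the gain is at least `log (1 + q) - 1`, whereas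
duality bounds the whole gap by `d * log q`. A large gap thus forces a large gain. -/
theorem designGap_add_single [DecidableEq ι] (hd : 0 < d) (x V : ι → Fin d → ℝ) {w : ι → ℝ}
    (hw : ∀ i, 0 ≤ w i) (hW : 0 < ∑ i, w i) (hpos : (designGram x w).PosDef) (p : ι)
    (hV : ∀ i, designGram x w *ᵥ V i = x i) (hp : ∀ i, x i ⬝ᵥ V i ≤ x p ⬝ᵥ V p)
    (hq : 8 * (d : ℝ) < (x p ⬝ᵥ V p) * ∑ i, w i) :
    designGap x (fun i => w i + if i = p then (∑ i, w i) / d else 0) ≤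
      designGap x w - max 1 (designGap x w / d - 1) := by
  have hd' : (0 : ℝ) < d := by positivity
  have hlev : 0 < x p ⬝ᵥ V p := by
    by_contra! h
    nlinarith
  have hq' : 8 < (x p ⬝ᵥ V p) * (∑ i, w i) / d := by rwa [lt_div_iff₀ hd']
  have hstep := designPotential_add_single hd x V hW hpos p (hV p) hlev.le
  have hgap : designGap x w ≤ d * Real.log ((x p ⬝ᵥ V p) * (∑ i, w i) / d) := by
    rw [designGap, sub_le_iff_le_add']
    refine csSup_le ⟨_, w, hw, hpos.det_pos, hW, rfl⟩ ?_
    rintro r ⟨w', hw', hdet, hW', rfl⟩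
    exact designPotential_le_add hd x V hw' hdet hW hW' hpos hV hlev hp
  set q := (x p ⬝ᵥ V p) * (∑ i, w i) / d
  have h1 : Real.log q ≤ Real.log (1 + q) := Real.log_le_log (by linarith) (by linarith)
  -- The threshold `8` is chosen for `exp 2 < 9`, so that each step gains at least `1`.
  have h2 : 2 ≤ Real.log (1 + q) := by
    rw [Real.le_log_iff_exp_le (by linarith)]
    have := Real.exp_one_lt_d9
    have h3 : Real.exp 2 = Real.exp 1 * Real.exp 1 := by rw [← Real.exp_add]; norm_num
    nlinarith [Real.exp_pos 1]
  have h3 : designGap x w / d ≤ Real.log q := by rwa [div_le_iff₀' hd']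
  have h4 : max 1 (designGap x w / d - 1) ≤ Real.log (1 + q) - 1 :=
    max_le (by linarith) (by linarith)
  rw [designGap] at h4 ⊢
  rw [designGap]
  linarith

/-- Cauchy–Schwarz for the weights `w`: `θ ⬝ᵥ u = ∑ w i (θ ⬝ᵥ x i) (v ⬝ᵥ x i)` and `u ⬝ᵥ v = ∑ w i
(v ⬝ᵥ x i)²`. -/
theorem dotProduct_sq_le_of_mulVec (x : ι → Fin d → ℝ) {w : ι → ℝ} (hw : ∀ i, 0 ≤ w i)
    {u v : Fin d → ℝ} (hv : designGram x w *ᵥ v = u) (θ : Fin d → ℝ) :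
    (θ ⬝ᵥ u) ^ 2 ≤ (u ⬝ᵥ v) * ∑ i, w i * (θ ⬝ᵥ x i) ^ 2 := by
  have hform : ∀ a b : Fin d → ℝ,
      a ⬝ᵥ designGram x w *ᵥ b = ∑ i, w i * ((a ⬝ᵥ x i) * (b ⬝ᵥ x i)) := by
    intro a b
    simp only [designGram, sum_mulVec, dotProduct_sum, smul_mulVec, vecMulVec_mulVec,
      op_smul_eq_smul, dotProduct_smul, smul_eq_mul]
    exact Finset.sum_congr rfl fun i _ => by rw [dotProduct_comm (x i) b]; ring
  rw [dotProduct_comm u v, ← hv, hform, hform, mul_comm]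
  refine Finset.sum_sq_le_sum_mul_sum_of_sq_le_mul _ (fun i _ => ?_) (fun i _ => ?_) fun i _ => ?_
  · have := hw i
    positivity
  · exact mul_nonneg (hw i) (mul_self_nonneg _)
  · apply le_of_eq
    ring

theorem dotProduct_sq_le_of_abs_le (x V : ι → Fin d → ℝ) {w : ι → ℝ} (hw : ∀ i, 0 ≤ w i)
    (hV : ∀ i, designGram x w *ᵥ V i = x i) {κ : ℝ} (hκ0 : 0 ≤ κ) (hκ : ∀ i, x i ⬝ᵥ V i ≤ κ)
    (θ : Fin d → ℝ) {B : ℝ} (hB : ∀ i, w i ≠ 0 → |θ ⬝ᵥ x i| ≤ B) (i : ι) :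
    (θ ⬝ᵥ x i) ^ 2 ≤ κ * (∑ i, w i) * B ^ 2 := by
  refine (dotProduct_sq_le_of_mulVec x hw (hV i) θ).trans ?_
  rw [mul_assoc, Finset.sum_mul]
  have hle : ∑ i, w i * (θ ⬝ᵥ x i) ^ 2 ≤ ∑ i, w i * B ^ 2 := by
    refine Finset.sum_le_sum fun k _ => ?_
    rcases eq_or_ne (w k) 0 with h | h
    · simp [h]
    · refine mul_le_mul_of_nonneg_left ?_ (hw k)
      rw [← sq_abs]
      exact pow_le_pow_left₀ (abs_nonneg _) (hB k h) 2
  exact mul_le_mul (hκ i) hle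
    (Finset.sum_nonneg fun k _ => mul_nonneg (hw k) (sq_nonneg _)) hκ0

/-- The design with unit weights at `r 0, …, r (d - 1)`. -/
def unitDesign [DecidableEq ι] (r : Fin d → ι) (i : ι) : ℝ :=
  ∑ j, if i = r j then 1 else 0

theorem unitDesign_nonneg [DecidableEq ι] (r : Fin d → ι) (i : ι) : 0 ≤ unitDesign r i :=
  Finset.sum_nonneg fun j _ => by split_ifs <;> norm_num

theorem exists_of_unitDesign_ne_zero [DecidableEq ι] {r : Fin d → ι} {i : ι}
    (h : unitDesign r i ≠ 0) : ∃ j, i = r j := by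
  obtain ⟨j, -, hj⟩ := Finset.exists_ne_zero_of_sum_ne_zero h
  exact ⟨j, by by_contra hne; exact hj (if_neg hne)⟩

theorem sum_unitDesign [DecidableEq ι] (r : Fin d → ι) : ∑ i, unitDesign r i = d := by
  simp only [unitDesign]
  rw [Finset.sum_comm]
  simp

theorem designGram_unitDesign [DecidableEq ι] (x : ι → Fin d → ℝ) (r : Fin d → ι)
    (hr : ∀ j, x (r j) = Pi.single j 1) : designGram x (unitDesign r) = 1 := by
  simp only [designGram, unitDesign, Finset.sum_smul, ite_smul, one_smul, zero_smul]
  rw [Finset.sum_comm]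
  simp only [Finset.sum_ite_eq', Finset.mem_univ, if_true, hr]
  ext a b
  simp only [Matrix.sum_apply, vecMulVec_apply, Pi.single_apply, Matrix.one_apply]
  rcases eq_or_ne a b with rfl | h
  · simp
  · rw [if_neg h]
    refine Finset.sum_eq_zero fun j _ => ?_
    split_ifs <;> simp_all

/-- The Gram matrix is the identity and the total weight is `d`, so the potential is `-d log d`,
while no design has positive potential. -/
theorem designGap_unitDesign_le [DecidableEq ι] (hd : 0 < d) (C : Matrix (Fin d) (Fin d) ℝ)
    (hC : C.det = 1) (x : ι → Fin d → ℝ) (hx : ∀ i, (C *ᵥ x i) ⬝ᵥ (C *ᵥ x i) ≤ d)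
    (r : Fin d → ι) (hr : ∀ j, x (r j) = Pi.single j 1) :
    designGap x (unitDesign r) ≤ d * Real.log d := by
  have hH := designGram_unitDesign x r hr
  have hs : sSup (designPotentials x) ≤ 0 := by
    refine csSup_le ⟨_, unitDesign r, unitDesign_nonneg r, ?_, ?_, rfl⟩ ?_
    · rw [hH, det_one]
      exact one_pos
    · rw [sum_unitDesign]
      positivity
    · rintro _ ⟨w, hw, hdet, -, rfl⟩
      exact designPotential_nonpos hd C hC x hx hw hdet
  rw [designGap, designPotential, hH, sum_unitDesign, det_one, Real.log_one]
  linarith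

/-- Needed to make the `sSup` in `designGap` a genuine supremum, hence the gap nonnegative. -/
theorem bddAbove_designPotentials (hd : 0 < d) (C : Matrix (Fin d) (Fin d) ℝ)
    (hC : C.det = 1) (x : ι → Fin d → ℝ) (hx : ∀ i, (C *ᵥ x i) ⬝ᵥ (C *ᵥ x i) ≤ d) :
    BddAbove (designPotentials x) := by
  refine ⟨0, ?_⟩
  rintro _ ⟨w, hw, hdet, -, rfl⟩
  exact designPotential_nonpos hd C hC x hx hw hdet

end Design

/-! ### Counting the greedy steps. -/

section StepBound

/-- A bound for the number of steps a design with gap `D` is away from being nearly optimal. -/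
noncomputable def stepBound (d : ℕ) (D : ℝ) : ℝ :=
  if D ≤ 2 * d then D else 2 * d + 1 + d * Real.log (D / d - 1)

theorem stepBound_nonneg (d : ℕ) {D : ℝ} (hd : 0 < d) (hD : 0 ≤ D) : 0 ≤ stepBound d D := by
  unfold stepBound
  split_ifs with h
  · exact hD
  · have hd' : (0 : ℝ) < d := by positivity
    have : 2 < D / d := by rw [lt_div_iff₀ hd']; linarith
    have := Real.log_nonneg (show 1 ≤ D / d - 1 by linarith)
    positivity

/-- Above `2d` the quantity `D / d - 1` shrinks by the factor `1 - 1 / d`, so `d` times its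
logarithm drops by one; below `2d` the gap itself drops by one. The extra `1` in the upper branch of
`stepBound` pays for the step that crosses the threshold. -/
theorem stepBound_add_one_le {d : ℕ} (hd : 0 < d) {D D' : ℝ}
    (h : D' ≤ D - max 1 (D / d - 1)) : stepBound d D' + 1 ≤ stepBound d D := by
  have hd' : (0 : ℝ) < d := by positivity
  have h1 := le_max_left 1 (D / d - 1)
  have h2 := le_max_right 1 (D / d - 1)
  unfold stepBound
  by_cases hD : D ≤ 2 * d
  · rw [if_pos hD, if_pos (by linarith)]
    linarith
  have h3 : 1 < D / d - 1 := by
    have : 2 < D / d := by rw [lt_div_iff₀ hd']; linarith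
    linarith
  rw [if_neg hD]
  split_ifs with hD'
  · have := mul_nonneg hd'.le (Real.log_nonneg h3.le)
    linarith
  · have h4 : 1 < D' / d - 1 := by
      have : 2 < D' / d := by rw [lt_div_iff₀ hd']; linarith
      linarith
    have h5 : D' / d - 1 ≤ (D / d - 1) * (1 - 1 / d) := by
      have : D' / d ≤ (D - (D / d - 1)) / d := by gcongr; linarith
      calc _ ≤ (D - (D / d - 1)) / d - 1 := by linarith
        _ = _ := by field_simp; ring
    have h6 : Real.log ((D' / d - 1) / (D / d - 1)) ≤ - (1 / d) := by
      have := Real.log_le_sub_one_of_pos (show 0 < (D' / d - 1) / (D / d - 1) by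
        apply div_pos <;> linarith)
      have h7 : (D' / d - 1) / (D / d - 1) ≤ 1 - 1 / d := by
        rw [div_le_iff₀ (by linarith)]; linarith
      linarith
    rw [Real.log_div (by linarith) (by linarith)] at h6
    have : (d : ℝ) * Real.log (D' / d - 1) ≤ d * (Real.log (D / d - 1) - 1 / d) := by
      gcongr; linarith
    have h8 : (d : ℝ) * (Real.log (D / d - 1) - 1 / d) = d * Real.log (D / d - 1) - 1 := by
      field_simp
    linarith

theorem stepBound_mono {d : ℕ} (hd : 0 < d) {D D' : ℝ} (h : D' ≤ D) :
    stepBound d D' ≤ stepBound d D := by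
  have hd' : (0 : ℝ) < d := by positivity
  unfold stepBound
  split_ifs with h1 h2 h2
  · exact h
  · have h3 : 1 < D / d - 1 := by
      have : 2 < D / d := by rw [lt_div_iff₀ hd']; linarith
      linarith
    have := mul_nonneg hd'.le (Real.log_nonneg h3.le)
    linarith
  · linarith
  · have h4 : 1 < D' / d - 1 := by
      have : 2 < D' / d := by rw [lt_div_iff₀ hd']; linarith
      linarith
    have : D' / d ≤ D / d := by gcongr
    have := Real.log_le_log (by linarith) (show D' / d - 1 ≤ D / d - 1 by linarith)
    gcongr

/-- A crude bound, enough for a running time stated up to logarithms. -/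
theorem stepBound_le_mul_log {d : ℕ} (hd : 0 < d) :
    stepBound d (d * Real.log d) ≤ 3 * d * (1 + Real.log d) := by
  have hd' : (1 : ℝ) ≤ d := by exact_mod_cast hd
  have h0 := Real.log_nonneg hd'
  unfold stepBound
  split_ifs with h
  · nlinarith
  · rw [mul_div_cancel_left₀ _ (by positivity)]
    have h2 : 2 < Real.log d := by
      by_contra! h2
      exact h (by nlinarith)
    have := Real.log_le_sub_one_of_pos (show 0 < Real.log d - 1 by linarith)
    nlinarith

/-- Lets terms linear in `M` be absorbed into `M log log M`. The function `y log log y - y`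
increases on `[2, ∞)`, as `log t ≥ 1 - 1 / t` at `t = log y` makes its derivative nonnegative; at
`2` it is at least `-2 / log 2 ≥ -3`. -/
theorem mul_log_log_ge {x : ℝ} (hx : 2 ≤ x) : x - 3 ≤ x * Real.log (Real.log x) := by
  have hder : ∀ y ∈ Set.Ici (2 : ℝ), HasDerivAt (fun y => y * Real.log (Real.log y) - y)
      (1 * Real.log (Real.log y) + y * (y⁻¹ / Real.log y) - 1) y := by
    intro y hy
    have hy2 : (2 : ℝ) ≤ y := hy
    have hl : 0 < Real.log y := Real.log_pos (by linarith)
    exact ((hasDerivAt_id y).mul ((Real.hasDerivAt_log (by linarith)).log hl.ne')).sub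
      (hasDerivAt_id y)
  have hmono : MonotoneOn (fun y => y * Real.log (Real.log y) - y) (Set.Ici (2 : ℝ)) := by
    refine monotoneOn_of_deriv_nonneg (convex_Ici 2)
      (fun y hy => (hder y hy).continuousAt.continuousWithinAt)
      (fun y hy => (hder y (interior_subset hy)).differentiableAt.differentiableWithinAt) ?_
    intro y hy
    have hy2 : (2 : ℝ) ≤ y := interior_subset hy
    rw [(hder y hy2).deriv]
    have hl : 0 < Real.log y := Real.log_pos (by linarith)
    have h1 := Real.one_sub_inv_le_log_of_pos hl
    have h2 : y * (y⁻¹ / Real.log y) = (Real.log y)⁻¹ := by field_simp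
    linarith
  have h := hmono (Set.mem_Ici.2 le_rfl) (Set.mem_Ici.2 hx) hx
  have h1 := Real.one_sub_inv_le_log_of_pos (Real.log_pos (show (1 : ℝ) < 2 by norm_num))
  have h2 : (Real.log 2)⁻¹ ≤ 3 / 2 := by
    rw [inv_le_comm₀ (Real.log_pos (by norm_num)) (by norm_num)]
    linarith [Real.log_two_gt_d9]
  simp only at h
  linarith

theorem natCast_mul_log_log_ge {M : ℕ} (hM : 1 ≤ M) :
    (M : ℝ) - 3 ≤ M * Real.log (Real.log M) := by
  rcases le_or_gt 2 M with h | h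
  · exact mul_log_log_ge (by exact_mod_cast h)
  · obtain rfl : M = 1 := by omega
    -- Here `log (log 1) = log 0 = 0` by convention, matching the reading of the bound at `M = 1`.
    norm_num

/-- In the main case the count is at most `3d + 1 + d log log d`. Three copies of `M - 3 ≤ M log log
M` absorb the linear part, whence the factor `4`. -/
theorem add_stepBound_le {d M : ℕ} (hd : 0 < d) (hdM : d ≤ M) :
    d + stepBound d (d * Real.log d) ≤ 4 * M * Real.log (Real.log M) + 16 := by
  have hd' : (1 : ℝ) ≤ d := by exact_mod_cast hd
  have hdM' : (d : ℝ) ≤ M := by exact_mod_cast hdM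
  have key := natCast_mul_log_log_ge (hd.trans_le hdM)
  unfold stepBound
  split_ifs with h
  · linarith
  · rw [mul_div_cancel_left₀ _ (by positivity)]
    have h2 : 2 < Real.log d := by
      by_contra! h2
      exact h (by nlinarith)
    have h3 : Real.log d ≤ Real.log M := Real.log_le_log (by linarith) hdM'
    have h4 : Real.log (Real.log d - 1) ≤ Real.log (Real.log M) :=
      Real.log_le_log (by linarith) (by linarith)
    have h5 : 0 ≤ Real.log (Real.log M) := Real.log_nonneg (by linarith)
    have h6 : (d : ℝ) * Real.log (Real.log d - 1) ≤ M * Real.log (Real.log M) :=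
      mul_le_mul hdM' h4 (Real.log_nonneg (by linarith)) (by linarith)
    linarith

end StepBound

/-! ### Total correctness with step counts for the machine, column sweeps and maxima. -/

namespace RealRAM

/-- Started in `s`, the program `p` halts within `T` operations in a memory satisfying `Q`. -/
def Spec (p : Prog) (s : State) (T : ℕ) (Q : State → Prop) : Prop :=
  ∃ s' t, Runs p s s' t ∧ t ≤ T ∧ Q s'

namespace Spec

theorem mono {p : Prog} {s : State} {T T' : ℕ} {Q Q' : State → Prop} (h : Spec p s T Q)
    (hT : T ≤ T') (hQ : ∀ s', Q s' → Q' s') : Spec p s T' Q' := by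
  obtain ⟨s', t, hr, ht, hq⟩ := h
  exact ⟨s', t, hr, ht.trans hT, hQ _ hq⟩

theorem seq {p q : Prog} {s : State} {T T' : ℕ} {R Q : State → Prop} (hp : Spec p s T R)
    (hq : ∀ s', R s' → Spec q s' T' Q) : Spec (.seq p q) s (T + T') Q := by
  obtain ⟨s', t, hr, ht, hR⟩ := hp
  obtain ⟨s'', t', hr', ht', hQ⟩ := hq s' hR
  exact ⟨s'', t + t', .seq hr hr', by omega, hQ⟩

theorem skip {s : State} {Q : State → Prop} (h : Q s) : Spec .skip s 1 Q :=
  ⟨s, 1, .skip s, le_rfl, h⟩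

theorem setNat {x : ℕ} {e : NExpr} {s : State} {Q : State → Prop}
    (h : Q (s.setNat x (e.eval s))) : Spec (.setNat x e) s (1 + e.cost) Q :=
  ⟨_, _, .setNat x e s, le_rfl, h⟩

theorem setReal {x : ℕ} {e : RExpr} {s : State} {Q : State → Prop}
    (h : Q (s.setReal x (e.eval s))) : Spec (.setReal x e) s (1 + e.cost) Q :=
  ⟨_, _, .setReal x e s, le_rfl, h⟩

theorem storeNat {x : ℕ} {i j e : NExpr} {s : State} {Q : State → Prop}
    (h : Q (s.storeNat x (i.eval s) (j.eval s) (e.eval s))) :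
    Spec (.storeNat x i j e) s (1 + i.cost + j.cost + e.cost) Q :=
  ⟨_, _, .storeNat x i j e s, le_rfl, h⟩

theorem storeReal {x : ℕ} {i j : NExpr} {e : RExpr} {s : State} {Q : State → Prop}
    (h : Q (s.storeReal x (i.eval s) (j.eval s) (e.eval s))) :
    Spec (.storeReal x i j e) s (1 + i.cost + j.cost + e.cost) Q :=
  ⟨_, _, .storeReal x i j e s, le_rfl, h⟩

theorem ite {b : BExpr} {p q : Prog} {s : State} {T : ℕ} {Q : State → Prop}
    (hp : b.holds s → Spec p s T Q) (hq : ¬ b.holds s → Spec q s T Q) :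
    Spec (.ite b p q) s (1 + b.cost + T) Q := by
  by_cases hb : b.holds s
  · obtain ⟨s', t, hr, ht, hQ⟩ := hp hb
    exact ⟨s', _, .ite_true hb hr, by omega, hQ⟩
  · obtain ⟨s', t, hr, ht, hQ⟩ := hq hb
    exact ⟨s', _, .ite_false hb hr, by omega, hQ⟩

/-- The index `k` counts iterations and need not be a program variable. Since `k < N` whenever the
test succeeds, induction on the remaining number of iterations gives termination. -/
theorem loop_aux {b : BExpr} {p : Prog} {T N : ℕ} {I : ℕ → State → Prop}
    (hN : ∀ k s, I k s → b.holds s → k < N)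
    (hstep : ∀ k s, I k s → b.holds s → Spec p s T (I (k + 1))) (n : ℕ) :
    ∀ k s, N ≤ k + n → I k s →
      Spec (.loop b p) s (n * (T + 1 + b.cost) + (1 + b.cost))
        (fun s' => (∃ k', I k' s') ∧ ¬ b.holds s') := by
  induction n with
  | zero =>
    intro k s hk hI
    have hb : ¬ b.holds s := fun hb => by have := hN k s hI hb; omega
    exact ⟨s, _, .loop_false hb, by omega, ⟨k, hI⟩, hb⟩
  | succ n ih =>
    intro k s hk hI
    by_cases hb : b.holds s
    · obtain ⟨s', t, hr, ht, hI'⟩ := hstep k s hI hb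
      obtain ⟨s'', t', hr', ht', hQ⟩ := ih (k + 1) s' (by omega) hI'
      refine ⟨s'', _, .loop_true hb hr hr', ?_, hQ⟩
      rw [Nat.succ_mul]
      omega
    · exact ⟨s, _, .loop_false hb, by rw [Nat.succ_mul]; omega, ⟨k, hI⟩, hb⟩

theorem loop {b : BExpr} {p : Prog} {T N : ℕ} {s : State} (I : ℕ → State → Prop)
    (h0 : I 0 s) (hN : ∀ k s, I k s → b.holds s → k < N)
    (hstep : ∀ k s, I k s → b.holds s → Spec p s T (I (k + 1))) :
    Spec (.loop b p) s (N * (T + 1 + b.cost) + (1 + b.cost))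
      (fun s' => (∃ k', I k' s') ∧ ¬ b.holds s') :=
  loop_aux hN hstep N 0 s (by omega) h0

end Spec

/-- Run `body` for the values `0, 1, …` of variable `x` below the value of variable `y`. -/
def forLoop (x y : ℕ) (body : Prog) : Prog :=
  .seq (.setNat x (.lit 0))
    (.loop (.natLt (.var x) (.var y)) (.seq body (.setNat x (.add (.var x) (.lit 1)))))

@[simp] theorem setNat_nat (s : State) (x v y : ℕ) :
    (s.setNat x v).nat y = if y = x then v else s.nat y := by
  simp [State.setNat, Function.update_apply]

@[simp] theorem setNat_real (s : State) (x v : ℕ) : (s.setNat x v).real = s.real := rfl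
@[simp] theorem setNat_natArr (s : State) (x v : ℕ) : (s.setNat x v).natArr = s.natArr := rfl
@[simp] theorem setNat_realArr (s : State) (x v : ℕ) : (s.setNat x v).realArr = s.realArr := rfl

@[simp] theorem setReal_real (s : State) (x : ℕ) (v : ℝ) (y : ℕ) :
    (s.setReal x v).real y = if y = x then v else s.real y := by
  simp [State.setReal, Function.update_apply]

@[simp] theorem setReal_nat (s : State) (x : ℕ) (v : ℝ) : (s.setReal x v).nat = s.nat := rfl
@[simp] theorem setReal_natArr (s : State) (x : ℕ) (v : ℝ) :
    (s.setReal x v).natArr = s.natArr := rfl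
@[simp] theorem setReal_realArr (s : State) (x : ℕ) (v : ℝ) :
    (s.setReal x v).realArr = s.realArr := rfl

@[simp] theorem storeNat_natArr (s : State) (x i j v y a b : ℕ) :
    (s.storeNat x i j v).natArr y a b =
      if y = x ∧ a = i ∧ b = j then v else s.natArr y a b := rfl
@[simp] theorem storeNat_nat (s : State) (x i j v : ℕ) : (s.storeNat x i j v).nat = s.nat := rfl
@[simp] theorem storeNat_real (s : State) (x i j v : ℕ) : (s.storeNat x i j v).real = s.real := rfl
@[simp] theorem storeNat_realArr (s : State) (x i j v : ℕ) :
    (s.storeNat x i j v).realArr = s.realArr := rfl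

@[simp] theorem storeReal_realArr (s : State) (x i j : ℕ) (v : ℝ) (y a b : ℕ) :
    (s.storeReal x i j v).realArr y a b =
      if y = x ∧ a = i ∧ b = j then v else s.realArr y a b := rfl
@[simp] theorem storeReal_nat (s : State) (x i j : ℕ) (v : ℝ) :
    (s.storeReal x i j v).nat = s.nat := rfl
@[simp] theorem storeReal_real (s : State) (x i j : ℕ) (v : ℝ) :
    (s.storeReal x i j v).real = s.real := rfl
@[simp] theorem storeReal_natArr (s : State) (x i j : ℕ) (v : ℝ) :
    (s.storeReal x i j v).natArr = s.natArr := rfl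

theorem Spec.forLoop {x y : ℕ} {body : Prog} {s : State} {N T : ℕ} (I : ℕ → State → Prop)
    (hx : ∀ k s, I k s → s.nat x = k) (hy : ∀ k s, I k s → s.nat y = N)
    (h0 : I 0 (s.setNat x 0))
    (hstep : ∀ k < N, ∀ s, I k s →
      Spec body s T (fun s' => I (k + 1) (s'.setNat x (s'.nat x + 1)))) :
    Spec (forLoop x y body) s (N * (T + 8) + 6) (I N) := by
  have hle : (I 0 (s.setNat x 0) ∧ 0 ≤ N) := ⟨h0, Nat.zero_le _⟩
  have hloop := Spec.loop (b := .natLt (.var x) (.var y))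
    (p := .seq body (.setNat x (.add (.var x) (.lit 1)))) (T := T + 4) (N := N)
    (fun k s => I k s ∧ k ≤ N) hle
    (fun k s h hb => by
      simpa only [BExpr.holds, NExpr.eval, hx k s h.1, hy k s h.1] using hb)
    (fun k s h hb => by
      have hk : k < N := by simpa only [BExpr.holds, NExpr.eval, hx k s h.1, hy k s h.1] using hb
      exact (hstep k hk s h.1).seq fun s' hs' => Spec.setNat ⟨hs', hk⟩)
  refine ((Spec.setNat (Q := fun s' => s' = s.setNat x 0) rfl).seq
    fun s' hs' => hs' ▸ hloop).mono (by simp only [NExpr.cost, BExpr.cost]; ring_nf; omega) ?_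
  rintro s' ⟨⟨k, hI, hk⟩, hb⟩
  have : k = N := by
    simp only [BExpr.holds, NExpr.eval, hx k s' hI, hy k s' hI] at hb
    omega
  exact this ▸ hI

/-- `s'` agrees with `s` except for the loop counters `6, 7`, the real variable `1` and the real
array `a`. -/
structure Frame (a : ℕ) (s s' : State) : Prop where
  nat : ∀ x, x ≠ 6 → x ≠ 7 → s'.nat x = s.nat x
  real : ∀ x, x ≠ 1 → s'.real x = s.real x
  natArr : s'.natArr = s.natArr
  realArr : ∀ b, b ≠ a → s'.realArr b = s.realArr b

theorem Frame.trans {a : ℕ} {s s' s'' : State} (h : Frame a s s') (h' : Frame a s' s'') :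
    Frame a s s'' :=
  ⟨fun x h6 h7 => (h'.nat x h6 h7).trans (h.nat x h6 h7),
    fun x hx => (h'.real x hx).trans (h.real x hx), h'.natArr.trans h.natArr,
    fun b hb => (h'.realArr b hb).trans (h.realArr b hb)⟩

/-- Overwrite column `j` of the real array `a`. -/
def storeCol (a : ℕ) (j : NExpr) (e : RExpr) : Prog :=
  forLoop 6 3 (.storeReal a (.var 6) j e)

/-- The expression may read the array being overwritten, so `he` exposes its exact partially updated
contents; this is what permits updates in place. -/
theorem Spec.storeCol {a K J : ℕ} {j : NExpr} {e : RExpr} {s : State} (hK : s.nat 3 = K)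
    (F : ℕ → ℝ)
    (he : ∀ i < K, ∀ s', Frame a s s' → s'.nat 6 = i → s'.nat 7 = s.nat 7 →
      s'.real 1 = s.real 1 →
      s'.realArr a = (fun i' j' => if i' < i ∧ j' = J then F i' else s.realArr a i' j') →
      j.eval s' = J ∧ e.eval s' = F i) :
    Spec (storeCol a j e) s (K * (j.cost + e.cost + 10) + 6) (fun s' =>
      Frame a s s' ∧ s'.nat 7 = s.nat 7 ∧ s'.real 1 = s.real 1 ∧
      s'.realArr a = fun i' j' => if i' < K ∧ j' = J then F i' else s.realArr a i' j') := by
  have := Spec.forLoop (x := 6) (y := 3) (body := .storeReal a (.var 6) j e) (s := s) (N := K)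
    (T := j.cost + e.cost + 2)
    (fun i s' => s'.nat 6 = i ∧ Frame a s s' ∧ s'.nat 7 = s.nat 7 ∧ s'.real 1 = s.real 1 ∧
      s'.realArr a = fun i' j' => if i' < i ∧ j' = J then F i' else s.realArr a i' j')
    (fun k s' h => h.1) (fun k s' h => by rw [h.2.1.nat 3 (by decide) (by decide), hK])
    (by
      refine ⟨by simp, ⟨fun x h6 h7 => by simp [h6], fun x hx => rfl, rfl, fun b hb => rfl⟩,
        by simp, rfl, by simp⟩)
    (by
      rintro i hi s' ⟨h6, hF, h7, h1, ha⟩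
      obtain ⟨hj, hv⟩ := he i hi s' hF h6 h7 h1 ha
      refine (Spec.storeReal ?_).mono (by simp only [NExpr.cost]; omega) fun _ h => h
      refine ⟨by simp [h6], ⟨fun x hx6 hx7 => by simp [hx6, hF.nat x hx6 hx7],
        fun x hx => by simp [hF.real x hx], by simp [hF.natArr], fun b hb => ?_⟩,
        by simp [h7], by simp [h1], ?_⟩
      · funext i' j'
        simp [hb, hF.realArr b hb]
      · funext i' j'
        simp only [setNat_realArr, storeReal_realArr, NExpr.eval, hj, hv, h6, ha, true_and]
        by_cases h : i' = i
        · subst h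
          by_cases h' : j' = J <;> simp [h']
        · have : i' < i + 1 ↔ i' < i := by omega
          simp [h, this])
  exact this.mono (by ring_nf; omega) fun s' h => h.2

/-- For each `j` below variable `4`, put the value of `c` into the real variable `1` and overwrite
column `col` of the real array `a`. -/
def sweep (a : ℕ) (c : RExpr) (col : NExpr) (e : RExpr) : Prog :=
  forLoop 7 4 (.seq (.setReal 1 c) (storeCol a col e))

/-- `G k` is the array after `k` columns. The scalar `cv k` is frozen in a real variable before its
column changes, because the entry it is read from may be overwritten during the pass. -/
theorem Spec.sweep {a K d : ℕ} {c : RExpr} {col : NExpr} {e : RExpr} {s : State}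
    (hK : s.nat 3 = K) (hd : s.nat 4 = d) (G : ℕ → ℕ → ℕ → ℝ) (J : ℕ → ℕ) (cv : ℕ → ℝ)
    (F : ℕ → ℕ → ℝ) (hG0 : G 0 = s.realArr a)
    (hG : ∀ k < d, ∀ i j, G (k + 1) i j = if i < K ∧ j = J k then F k i else G k i j)
    (hc : ∀ k < d, ∀ s', Frame a s s' → s'.nat 7 = k → s'.realArr a = G k → c.eval s' = cv k)
    (he : ∀ k < d, ∀ i < K, ∀ s', Frame a s s' → s'.nat 6 = i → s'.nat 7 = k →
      s'.real 1 = cv k →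
      s'.realArr a = (fun i' j' => if i' < i ∧ j' = J k then F k i' else G k i' j') →
      col.eval s' = J k ∧ e.eval s' = F k i) :
    Spec (sweep a c col e) s (d * (c.cost + (K * (col.cost + e.cost + 10)) + 15) + 6) (fun s' =>
      Frame a s s' ∧ s'.realArr a = G d) := by
  have := Spec.forLoop (x := 7) (y := 4)
    (body := .seq (.setReal 1 c) (RealRAM.storeCol a col e)) (s := s) (N := d) (T := (1 + c.cost) + (K * (col.cost + e.cost + 10) + 6))
    (fun k s' => s'.nat 7 = k ∧ Frame a s s' ∧ s'.realArr a = G k)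
    (fun k s' h => h.1) (fun k s' h => by rw [h.2.1.nat 4 (by decide) (by decide), hd])
    ⟨by simp, ⟨fun x h6 h7 => by simp [h7], fun x hx => rfl, rfl, fun b hb => rfl⟩, hG0.symm⟩
    (by
      rintro k hk s' ⟨h7, hF, ha⟩
      have hF1 : Frame a s (s'.setReal 1 (c.eval s')) :=
        hF.trans ⟨fun x _ _ => rfl, fun x hx => by simp [hx], rfl, fun b hb => rfl⟩
      refine (Spec.setReal (Q := fun s1 => s1 = s'.setReal 1 (c.eval s')) rfl).seq ?_
      rintro s1 rfl
      rw [hc k hk s' hF h7 ha] at hF1 ⊢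
      refine (Spec.storeCol (K := K) (J := J k) ?_ (F k) ?_).mono le_rfl ?_
      · simp [hF.nat 3, hK]
      · intro i hi s2 hF2 h26 h27 h21 h2a
        refine he k hk i hi s2 (hF1.trans hF2) h26 (by simp [h27, h7]) (by simp [h21]) ?_
        rw [h2a]
        simp [ha]
      · rintro s2 ⟨hF2, h27, h21, h2a⟩
        refine ⟨by simp [h27, h7], (hF1.trans hF2).trans
          ⟨fun x hx6 hx7 => by simp [hx7], fun x hx => rfl, rfl, fun b hb => rfl⟩, ?_⟩
        funext i j
        rw [setNat_realArr, h2a, hG k hk]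
        simp [ha])
  exact this.mono (by ring_nf; omega) fun s' h => h.2

/-- Put the maximum of `0` and the values of `e` over the values of variable `6` below variable `3`
into the real variable `0`, and an index where it is attained into variable `8`. -/
def argmax (e : RExpr) : Prog :=
  .seq (.setReal 0 (.ofNat (.lit 0))) (.seq (.setNat 8 (.lit 0))
    (forLoop 6 3 (.ite (.realLt (.var 0) e)
      (.seq (.setReal 0 e) (.setNat 8 (.var 6))) .skip)))

/-- `s'` agrees with `s` except for the variables `6, 8` and the real variable `0`. -/
structure ArgmaxFrame (s s' : State) : Prop where
  nat : ∀ x, x ≠ 6 → x ≠ 8 → s'.nat x = s.nat x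
  real : ∀ x, x ≠ 0 → s'.real x = s.real x
  natArr : s'.natArr = s.natArr
  realArr : s'.realArr = s.realArr

/-- The running maximum starts at `0`, so the index is known to attain it only when it is positive;
it is always a valid row. -/
theorem Spec.argmax {e : RExpr} {K : ℕ} {s : State} (hK : s.nat 3 = K) (hK0 : 0 < K) (f : ℕ → ℝ)
    (he : ∀ i < K, ∀ s', ArgmaxFrame s s' → s'.nat 6 = i → e.eval s' = f i) :
    Spec (argmax e) s (K * (2 * e.cost + 15) + 12) (fun s' => ArgmaxFrame s s' ∧
      (∀ i < K, f i ≤ s'.real 0) ∧ 0 ≤ s'.real 0 ∧ s'.nat 8 < K ∧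
      (0 < s'.real 0 → f (s'.nat 8) = s'.real 0)) := by
  have := Spec.forLoop (x := 6) (y := 3) (body := .ite (.realLt (.var 0) e)
      (.seq (.setReal 0 e) (.setNat 8 (.var 6))) .skip) (s := (s.setReal 0 0).setNat 8 0)
    (N := K) (T := 2 * e.cost + 7)
    (fun k s' => s'.nat 6 = k ∧ ArgmaxFrame s s' ∧ (∀ i < k, f i ≤ s'.real 0) ∧ 0 ≤ s'.real 0 ∧
      s'.nat 8 < K ∧ (0 < s'.real 0 → f (s'.nat 8) = s'.real 0))
    (fun k s' h => h.1) (fun k s' h => by rw [h.2.1.nat 3 (by decide) (by decide), hK])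
    (by
      refine ⟨by simp, ⟨fun x h6 h8 => by simp [h6, h8], fun x hx => by simp [hx], rfl, rfl⟩,
        by simp, by simp, by simpa using hK0, by simp⟩)
    (by
      rintro k hk s' ⟨h6, hF, hmax, h0, h8, hp⟩
      have hev := he k hk s' hF h6
      refine (Spec.ite (T := e.cost + 3) (fun hb => ?_) fun hb => ?_).mono
        (by simp only [BExpr.cost, RExpr.cost]; omega) fun _ h => h
      · simp only [BExpr.holds, RExpr.eval, hev] at hb
        refine ((Spec.setReal (Q := fun s1 => s1 = s'.setReal 0 (f k)) (by rw [hev])).seq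
          (T' := 2) ?_).mono (by omega) fun _ h => h
        rintro s1 rfl
        refine Spec.setNat ?_
        refine ⟨by simp [h6], ⟨fun x hx6 hx8 => by simp [hx6, hx8, hF.nat x hx6 hx8],
          fun x hx => by simp [hx, hF.real x hx], by simp [hF.natArr], by simp [hF.realArr]⟩,
          ?_, ?_, ?_, ?_⟩
        · intro i hi
          simp only [setNat_real, setReal_real, if_true]
          rcases Nat.lt_succ_iff_lt_or_eq.1 hi with h | rfl
          · exact (hmax i h).trans hb.le
          · exact le_rfl
        · simpa using h0.trans hb.le
        · simpa [NExpr.eval, h6] using hk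
        · simp [NExpr.eval, h6]
      · simp only [BExpr.holds, RExpr.eval, hev, not_lt] at hb
        refine (Spec.skip ?_).mono (by omega) fun _ h => h
        refine ⟨by simp [h6], ⟨fun x hx6 hx8 => by simp [hx6, hF.nat x hx6 hx8],
          fun x hx => by simp [hF.real x hx], by simp [hF.natArr], by simp [hF.realArr]⟩,
          ?_, by simpa using h0, by simpa using h8, by simpa using hp⟩
        intro i hi
        rcases Nat.lt_succ_iff_lt_or_eq.1 hi with h | rfl
        · exact hmax i h
        · exact hb)
  refine (Spec.seq (Spec.setReal (Q := fun s1 => s1 = s.setReal 0 0)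
    (by simp [RExpr.eval, NExpr.eval]))
    (T' := 2 + (K * (2 * e.cost + 7 + 8) + 6)) ?_).mono
    (by simp only [RExpr.cost, NExpr.cost]; ring_nf; omega) fun s' h => h
  rintro s1 rfl
  refine Spec.seq (Spec.setNat (Q := fun s1 => s1 = (s.setReal 0 0).setNat 8 0) rfl) ?_
  rintro s1 rfl
  exact this.mono le_rfl fun s' h => h.2

end RealRAM

/-! ### Dual bases produced by elimination with maximal pivots. -/

section PivotBasis

variable {ι : Type*}

/-- The functions `x 0, …, x (d - 1)` are a basis of `S` dual to the evaluations at
`r 0, …, r (d - 1)`, and `y 0, …, y (d - 1)` are elements of `S` bounded by one whose values at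
these points form a unitriangular matrix. -/
structure PivotBasis (d : ℕ) (S : Submodule ℝ (ι → ℝ)) (r : ℕ → ι) (x y : ℕ → ι → ℝ) : Prop where
  span_eq : Submodule.span ℝ (x '' Set.Iio d) = S
  dual : ∀ j < d, ∀ k < d, x j (r k) = if j = k then 1 else 0
  mem : ∀ j < d, y j ∈ S
  abs_le : ∀ j < d, ∀ q, |y j q| ≤ 1
  diag : ∀ j < d, y j (r j) = 1
  lower : ∀ j < d, ∀ k < j, y j (r k) = 0

namespace PivotBasis

variable {d : ℕ} {S S' : Submodule ℝ (ι → ℝ)} {r r' : ℕ → ι} {x x' y : ℕ → ι → ℝ}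

theorem zero (r : ℕ → ι) (x y : ℕ → ι → ℝ) : PivotBasis 0 ⊥ r x y where
  span_eq := by simp
  dual := by simp
  mem := by simp
  abs_le := by simp
  diag := by simp
  lower := by simp

theorem basis_mem (h : PivotBasis d S r x y) {j : ℕ} (hj : j < d) : x j ∈ S :=
  h.span_eq ▸ Submodule.subset_span ⟨j, hj, rfl⟩

/-- Interpolation at the pivots: both sides are linear in `u` and agree on the spanning functions by
duality. -/
theorem eq_sum (h : PivotBasis d S r x y) {u : ι → ℝ} (hu : u ∈ S) :
    u = ∑ j ∈ Finset.range d, u (r j) • x j := by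
  rw [← h.span_eq] at hu
  induction hu using Submodule.span_induction with
  | mem u hu =>
    obtain ⟨k, hk, rfl⟩ := hu
    rw [Finset.sum_eq_single_of_mem k (Finset.mem_range.2 hk)]
    · rw [h.dual k hk k hk, if_pos rfl, one_smul]
    · intro j hj hne
      rw [h.dual k hk j (Finset.mem_range.1 hj), if_neg hne.symm, zero_smul]
  | zero => simp
  | add u v _ _ hu hv =>
    simp only [Pi.add_apply, add_smul, Finset.sum_add_distrib]
    rw [← hu, ← hv]
  | smul c u _ hu =>
    simp only [Pi.smul_apply, smul_eq_mul, mul_smul, ← Finset.smul_sum]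
    rw [← hu]

theorem sum_mem (h : PivotBasis d S r x y) (c : ℕ → ℝ) :
    ∑ j ∈ Finset.range d, c j • x j ∈ S :=
  Submodule.sum_mem _ fun _ hj => S.smul_mem _ (h.basis_mem (Finset.mem_range.1 hj))

theorem pivot_injOn (h : PivotBasis d S r x y) {j k : ℕ} (hj : j < d) (hk : k < d)
    (hjk : r j = r k) : j = k := by
  by_contra hne
  have h1 := h.dual j hj k hk
  rw [if_neg hne, ← hjk, h.dual j hj j hj, if_pos rfl] at h1
  exact one_ne_zero h1

theorem congr (h : PivotBasis d S r x y) (hr : ∀ j < d, r' j = r j) (hx : ∀ j < d, x' j = x j)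
    (hS : S' = S) : PivotBasis d S' r' x' y where
  span_eq := by
    rw [hS, ← h.span_eq]
    exact congrArg _ (Set.image_congr fun j hj => hx j hj)
  dual j hj k hk := by rw [hx j hj, hr k hk, h.dual j hj k hk]
  mem j hj := hS ▸ h.mem j hj
  abs_le := h.abs_le
  diag j hj := by rw [hr j hj, h.diag j hj]
  lower j hj k hk := by rw [hr k (hk.trans hj), h.lower j hj k hk]

/-- Since `z` vanishes at the old pivots, subtracting multiples of it clears the old functions at
the new pivot without disturbing duality elsewhere. The same vanishing keeps the values of `y`
unitriangular. -/
theorem insert (h : PivotBasis d S r x y) {z : ι → ℝ} {q : ι} (hz1 : z q = 1)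
    (hz0 : ∀ k < d, z (r k) = 0) (hzle : ∀ q, |z q| ≤ 1) (hr : ∀ j < d, r' j = r j)
    (hrd : r' d = q) (hx : ∀ j < d, x' j = x j - x j q • z) (hxd : x' d = z)
    (hS : S' = S ⊔ Submodule.span ℝ {z}) :
    PivotBasis (d + 1) S' r' x' (Function.update y d z) := by
  have hz : z ∈ S' := hS ▸ Submodule.mem_sup_right (Submodule.mem_span_singleton_self z)
  have hle : S ≤ S' := hS ▸ le_sup_left
  refine ⟨le_antisymm ?_ ?_, ?_, ?_, ?_, ?_, ?_⟩
  · rw [Submodule.span_le]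
    rintro _ ⟨j, hj, rfl⟩
    rcases Nat.lt_succ_iff_lt_or_eq.1 hj with hj | rfl
    · rw [hx j hj]
      exact S'.sub_mem (hle (h.basis_mem hj)) (S'.smul_mem _ hz)
    · rw [hxd]
      exact hz
  · have hzm : z ∈ Submodule.span ℝ (x' '' Set.Iio (d + 1)) :=
      Submodule.subset_span ⟨d, Nat.lt_succ_self d, hxd⟩
    rw [hS, ← h.span_eq, sup_le_iff, Submodule.span_le, Submodule.span_le]
    refine ⟨?_, by simpa using hzm⟩
    rintro _ ⟨j, hj, rfl⟩
    have : x j = x' j + x j q • z := by rw [hx j hj, sub_add_cancel]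
    rw [this]
    exact Submodule.add_mem _ (Submodule.subset_span ⟨j, Nat.lt_succ_of_lt hj, rfl⟩)
      (Submodule.smul_mem _ _ hzm)
  · intro j hj k hk
    rcases Nat.lt_succ_iff_lt_or_eq.1 hj with hj | rfl <;>
      rcases Nat.lt_succ_iff_lt_or_eq.1 hk with hk | rfl
    · simp [hx j hj, hr k hk, h.dual j hj k hk, hz0 k hk]
    · simp [hx j hj, hrd, hz1, hj.ne]
    · simp [hxd, hr k hk, hz0 k hk, hk.ne']
    · simp [hxd, hrd, hz1]
  · intro j hj
    rcases Nat.lt_succ_iff_lt_or_eq.1 hj with hj | rfl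
    · simpa [Function.update_apply, hj.ne] using hle (h.mem j hj)
    · simpa using hz
  · intro j hj
    rcases Nat.lt_succ_iff_lt_or_eq.1 hj with hj | rfl
    · simpa [Function.update_apply, hj.ne] using h.abs_le j hj
    · simpa using hzle
  · intro j hj
    rcases Nat.lt_succ_iff_lt_or_eq.1 hj with hj | rfl
    · simpa [Function.update_apply, hj.ne, hr j hj] using h.diag j hj
    · simpa [hrd] using hz1
  · intro j hj k hk
    rcases Nat.lt_succ_iff_lt_or_eq.1 hj with hj | rfl
    · simpa [Function.update_apply, hj.ne, hr k (hk.trans hj)] using h.lower j hj k hk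
    · simpa [hr k hk] using hz0 k hk

end PivotBasis

end PivotBasis

/-! ### Numbering the rows by action-value pairs. -/

namespace RealRAM

/-- The number of the row of an action-value pair. -/
def rowIndex {A Z : ℕ} (q : Fin A × Fin Z) : ℕ := q.1 * Z + q.2

theorem rowIndex_lt {A Z : ℕ} (q : Fin A × Fin Z) : rowIndex q < A * Z := by
  have h1 := q.1.2
  have h2 := q.2.2
  have : ((q.1 : ℕ) + 1) * Z ≤ A * Z := Nat.mul_le_mul_right _ h1
  unfold rowIndex
  linarith

theorem mul_add_inj {Z a a' z z' : ℕ} (hz : z < Z) (hz' : z' < Z) (h : a * Z + z = a' * Z + z') :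
    a = a' ∧ z = z' := by
  have hZ : 0 < Z := by omega
  have h1 := congrArg (· / Z) h
  have h2 := congrArg (· % Z) h
  simp only [mul_comm _ Z, Nat.mul_add_div hZ, Nat.mul_add_mod, Nat.div_eq_of_lt hz,
    Nat.div_eq_of_lt hz', Nat.mod_eq_of_lt hz, Nat.mod_eq_of_lt hz', add_zero] at h1 h2
  exact ⟨h1, h2⟩

theorem rowIndex_injective {A Z : ℕ} :
    Function.Injective (rowIndex : Fin A × Fin Z → ℕ) := by
  intro q q' h
  obtain ⟨h1, h2⟩ := mul_add_inj q.2.2 q'.2.2 h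
  exact Prod.ext (Fin.ext h1) (Fin.ext h2)

theorem exists_rowIndex_eq {A Z i : ℕ} (hi : i < A * Z) :
    ∃ q : Fin A × Fin Z, rowIndex q = i := by
  have hZ : 0 < Z := Nat.pos_of_ne_zero (by rintro rfl; simp at hi)
  refine ⟨⟨⟨i / Z, by rwa [Nat.div_lt_iff_lt_mul hZ]⟩, ⟨i % Z, Nat.mod_lt _ hZ⟩⟩, ?_⟩
  simp only [rowIndex]
  rw [mul_comm]
  exact Nat.div_add_mod i Z

/-- Tabulate the action and the value of each row in the columns `0, 1` of the array `1`. -/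
def tabulate : Prog :=
  .seq (.setNat 3 (.mul (.var 0) (.var 1))) (forLoop 6 3
    (.seq (.storeNat 1 (.var 6) (.lit 0) (.var 10))
    (.seq (.storeNat 1 (.var 6) (.lit 1) (.var 11))
    (.seq (.setNat 11 (.add (.var 11) (.lit 1)))
      (.ite (.natLt (.var 11) (.var 1)) .skip
        (.seq (.setNat 11 (.lit 0)) (.setNat 10 (.add (.var 10) (.lit 1)))))))))

/-- The machine has no integer division, so variables `10` and `11` are kept as quotient and
remainder of the row number by `Z`, the remainder carrying into the quotient. -/
theorem tabulate_spec {A Z : ℕ} (hZ : 1 ≤ Z) (s : State) (h0 : s.nat 0 = A) (h1 : s.nat 1 = Z)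
    (h10 : s.nat 10 = 0) (h11 : s.nat 11 = 0) :
    Spec tabulate s (A * Z * 40 + 20) (fun s' =>
      s'.nat 3 = A * Z ∧ (∀ x, x ≠ 3 → x ≠ 6 → x ≠ 10 → x ≠ 11 → s'.nat x = s.nat x) ∧
      s'.real = s.real ∧ s'.realArr = s.realArr ∧ (∀ b, b ≠ 1 → s'.natArr b = s.natArr b) ∧
      ∀ q : Fin A × Fin Z,
        s'.natArr 1 (rowIndex q) 0 = q.1 ∧ s'.natArr 1 (rowIndex q) 1 = q.2) := by
  refine (Spec.seq (Spec.setNat (Q := fun s1 => s1 = s.setNat 3 (A * Z))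
    (by simp [NExpr.eval, h0, h1])) (T' := A * Z * (32 + 8) + 6)
    (Q := fun s' => s'.nat 6 = A * Z ∧ s'.nat 3 = A * Z ∧
      (∀ x, x ≠ 3 → x ≠ 6 → x ≠ 10 → x ≠ 11 → s'.nat x = s.nat x) ∧
      s'.real = s.real ∧ s'.realArr = s.realArr ∧ (∀ b, b ≠ 1 → s'.natArr b = s.natArr b) ∧
      s'.nat 10 * Z + s'.nat 11 = A * Z ∧ s'.nat 11 < Z ∧
      ∀ i < A * Z, s'.natArr 1 i 0 * Z + s'.natArr 1 i 1 = i ∧ s'.natArr 1 i 1 < Z) ?_).mono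
    (by simp only [NExpr.cost]; omega) ?_
  · rintro s1 rfl
    refine Spec.forLoop (N := A * Z) (fun k s' => s'.nat 6 = k ∧ s'.nat 3 = A * Z ∧
      (∀ x, x ≠ 3 → x ≠ 6 → x ≠ 10 → x ≠ 11 → s'.nat x = s.nat x) ∧
      s'.real = s.real ∧ s'.realArr = s.realArr ∧ (∀ b, b ≠ 1 → s'.natArr b = s.natArr b) ∧
      s'.nat 10 * Z + s'.nat 11 = k ∧ s'.nat 11 < Z ∧
      ∀ i < k, s'.natArr 1 i 0 * Z + s'.natArr 1 i 1 = i ∧ s'.natArr 1 i 1 < Z)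
      (fun k s h => h.1) (fun k s h => h.2.1) ?_ ?_
    · refine ⟨by simp, by simp, fun x h3 h6 _ _ => by simp [h3, h6], rfl, rfl, fun _ _ => rfl,
        by simp [h10, h11], by simp [h11]; omega, by simp⟩
    · rintro k hk t ⟨h6, h3, hn, hr, hra, hna, hkz, hz, htab⟩
      have ht1 : t.nat 1 = Z := by rw [hn 1 (by decide) (by decide) (by decide) (by decide), h1]
      refine (Spec.seq (Spec.storeNat (Q := fun t' => t' = t.storeNat 1 k 0 (t.nat 10))
        (by simp [NExpr.eval, h6])) (T' := 25) ?_).mono (by simp only [NExpr.cost]; omega)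
        fun _ h => h
      rintro _ rfl
      refine (Spec.seq (Spec.storeNat
        (Q := fun t' => t' = (t.storeNat 1 k 0 (t.nat 10)).storeNat 1 k 1 (t.nat 11))
        (by simp [NExpr.eval, h6])) (T' := 20) ?_).mono (by simp only [NExpr.cost]; omega)
        fun _ h => h
      rintro _ rfl
      refine (Spec.seq (Spec.setNat (Q := fun t' => t' = ((t.storeNat 1 k 0 (t.nat 10)).storeNat
        1 k 1 (t.nat 11)).setNat 11 (t.nat 11 + 1)) (by simp [NExpr.eval])) (T' := 15) ?_).mono
        (by simp only [NExpr.cost]; omega) fun _ h => h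
      rintro _ rfl
      have htab' : ∀ i < k + 1,
          ((t.storeNat 1 k 0 (t.nat 10)).storeNat 1 k 1 (t.nat 11)).natArr 1 i 0 * Z +
            ((t.storeNat 1 k 0 (t.nat 10)).storeNat 1 k 1 (t.nat 11)).natArr 1 i 1 = i ∧
          ((t.storeNat 1 k 0 (t.nat 10)).storeNat 1 k 1 (t.nat 11)).natArr 1 i 1 < Z := by
        intro i hi
        rcases Nat.lt_succ_iff_lt_or_eq.1 hi with h | rfl
        · simpa [h.ne] using htab i h
        · simp [hkz, hz]
      have hna' : ∀ b, b ≠ 1 →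
          ((t.storeNat 1 k 0 (t.nat 10)).storeNat 1 k 1 (t.nat 11)).natArr b = s.natArr b := by
        intro b hb
        funext i j
        simp [hb, hna b hb]
      refine (Spec.ite (T := 6) (fun hb => ?_) fun hb => ?_).mono
        (by simp only [BExpr.cost, NExpr.cost]; omega) fun _ h => h
      · simp only [BExpr.holds, NExpr.eval, setNat_nat, storeNat_nat, ht1, if_true,
          show (1 : ℕ) ≠ 11 by decide, if_false] at hb
        refine (Spec.skip ?_).mono (by omega) fun _ h => h
        refine ⟨by simp [h6], by simp [h3], fun x hx3 hx6 hx10 hx11 => ?_, by simpa using hr,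
          by simpa using hra, hna', by simp; omega, by simpa using hb, htab'⟩
        simp [hx6, hx11, hn x hx3 hx6 hx10 hx11]
      · simp only [BExpr.holds, NExpr.eval, setNat_nat, storeNat_nat, ht1, if_true,
          show (1 : ℕ) ≠ 11 by decide, if_false, not_lt] at hb
        have hzZ : t.nat 11 + 1 = Z := by omega
        refine (Spec.seq (Spec.setNat (Q := fun t' => t' = (((t.storeNat 1 k 0
          (t.nat 10)).storeNat 1 k 1 (t.nat 11)).setNat 11 (t.nat 11 + 1)).setNat 11 0)
          (by simp [NExpr.eval])) (T' := 4) ?_).mono (by simp only [NExpr.cost]; omega)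
          fun _ h => h
        rintro _ rfl
        refine (Spec.setNat ?_).mono (by simp only [NExpr.cost]; omega) fun _ h => h
        refine ⟨by simp [h6], by simp [h3], fun x hx3 hx6 hx10 hx11 => ?_, by simpa using hr,
          by simpa using hra, hna', ?_, by simp; omega, htab'⟩
        · simp [hx6, hx10, hx11, hn x hx3 hx6 hx10 hx11]
        · simp [NExpr.eval, add_mul]
          omega
  · rintro s' ⟨-, h3, hn, hr, hra, hna, -, -, htab⟩
    refine ⟨h3, hn, hr, hra, hna, fun q => ?_⟩
    obtain ⟨h, h'⟩ := htab _ (rowIndex_lt q)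
    exact mul_add_inj h' q.2.2 h

end RealRAM

/-! ### Elimination on the machine. -/

namespace RealRAM

/-- Append the pair in row `8` to the core pairs, whose number is in variable `x`. -/
def appendCore (x : ℕ) : Prog :=
  .seq (.storeNat 0 (.var x) (.lit 0) (.arr 1 (.var 8) (.lit 0)))
  (.seq (.storeNat 0 (.var x) (.lit 1) (.arr 1 (.var 8) (.lit 1)))
  (.seq (.storeNat 2 (.var 8) (.lit 0) (.lit 1))
    (.setNat x (.add (.var x) (.lit 1)))))

/-- The memory describes the action-value pairs of the rows, and the first `n` core pairs
`r 0, …, r (n - 1)` together with their membership flags. -/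
structure CoreInv {A Z : ℕ} (n : ℕ) (r : ℕ → Fin A × Fin Z) (s : State) : Prop where
  table : ∀ q : Fin A × Fin Z,
    s.natArr 1 (rowIndex q) 0 = q.1 ∧ s.natArr 1 (rowIndex q) 1 = q.2
  core : ∀ j < n, s.natArr 0 j 0 = (r j).1 ∧ s.natArr 0 j 1 = (r j).2
  flag : ∀ q : Fin A × Fin Z, s.natArr 2 (rowIndex q) 0 = 0 ↔ ∀ j < n, r j ≠ q

theorem CoreInv.congr {A Z n : ℕ} {r : ℕ → Fin A × Fin Z} {s s' : State} (h : CoreInv n r s)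
    (hs : s'.natArr = s.natArr) : CoreInv n r s' :=
  ⟨by rw [hs]; exact h.table, by rw [hs]; exact h.core, by rw [hs]; exact h.flag⟩

/-- The flag makes later membership tests constant time; distinct pairs have distinct rows, so
setting one flag affects no other pair. -/
theorem appendCore_spec {A Z n x : ℕ} {r : ℕ → Fin A × Fin Z} {s : State} (h : CoreInv n r s)
    (hx : s.nat x = n) (q : Fin A × Fin Z) (hq : s.nat 8 = rowIndex q) :
    Spec (appendCore x) s 27 (fun s' => CoreInv (n + 1) (Function.update r n q) s' ∧
      s'.real = s.real ∧ s'.realArr = s.realArr ∧ s'.nat x = n + 1 ∧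
      ∀ y, y ≠ x → s'.nat y = s.nat y) := by
  obtain ⟨hq1, hq2⟩ := h.table q
  refine (Spec.seq (Spec.storeNat (Q := fun t => t = s.storeNat 0 n 0 q.1)
    (by simp [NExpr.eval, hx, hq, hq1])) (T' := 20) ?_).mono (by simp only [NExpr.cost]; omega)
    fun _ h => h
  rintro _ rfl
  refine (Spec.seq (Spec.storeNat (Q := fun t => t = (s.storeNat 0 n 0 q.1).storeNat 0 n 1 q.2)
    (by simp [NExpr.eval, hx, hq, hq2])) (T' := 13) ?_).mono (by simp only [NExpr.cost]; omega)
    fun _ h => h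
  rintro _ rfl
  refine (Spec.seq (Spec.storeNat (Q := fun t => t =
    ((s.storeNat 0 n 0 q.1).storeNat 0 n 1 q.2).storeNat 2 (rowIndex q) 0 1)
    (by simp [NExpr.eval, hq])) (T' := 5) ?_).mono (by simp only [NExpr.cost]; omega)
    fun _ h => h
  rintro _ rfl
  refine (Spec.setNat ?_).mono (by simp only [NExpr.cost]; omega) fun _ h => h
  refine ⟨⟨fun q' => by simpa using h.table q', fun j hj => ?_, fun q' => ?_⟩, rfl, rfl,
    by simp [NExpr.eval, hx], fun y hy => by simp [hy]⟩
  · rcases Nat.lt_succ_iff_lt_or_eq.1 hj with hj | rfl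
    · simpa [hj.ne] using h.core j hj
    · simp
  · by_cases hqq : q' = q
    · subst hqq
      simp only [setNat_natArr, storeNat_natArr, and_self, if_true, one_ne_zero, false_iff,
        not_forall]
      exact ⟨n, Nat.lt_succ_self n, by simp⟩
    · have hne : rowIndex q' ≠ rowIndex q := fun h => hqq (rowIndex_injective h)
      simp only [setNat_natArr, storeNat_natArr, hne, false_and, and_false, if_false,
        show (2 : ℕ) ≠ 0 by decide, h.flag q']
      constructor
      · intro hf j hj
        rcases Nat.lt_succ_iff_lt_or_eq.1 hj with hj | rfl
        · simpa [Function.update_apply, hj.ne] using hf j hj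
        · simpa using Ne.symm hqq
      · intro hf j hj
        simpa [Function.update_apply, hj.ne] using hf j (Nat.lt_succ_of_lt hj)

/-- The row of the core pair whose number is in variable `7`. -/
def coreRow : NExpr :=
  .add (.mul (.arr 0 (.var 7) (.lit 0)) (.var 1)) (.arr 0 (.var 7) (.lit 1))

/-- Subtract from column `5` of the array `0` the combination of the columns of the array `1` with
the same values at the pivots. -/
def reduceColumn : Prog :=
  sweep 0 (.arr 0 coreRow (.var 5)) (.var 5)
    (.sub (.arr 0 (.var 6) (.var 5)) (.mul (.var 1) (.arr 1 (.var 6) (.var 7))))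

theorem reduceColumn_spec {K d m : ℕ} {s : State} {R : ℕ → ℕ} (hK : s.nat 3 = K)
    (hd : s.nat 4 = d) (hm : s.nat 5 = m) (hR : ∀ j < d, R j < K)
    (hrow : ∀ j < d, s.natArr 0 j 0 * s.nat 1 + s.natArr 0 j 1 = R j)
    (hdual : ∀ j < d, ∀ k < d, s.realArr 1 (R k) j = if j = k then 1 else 0) :
    Spec reduceColumn s (d * (K * 20 + 40) + 6) (fun s' => Frame 0 s s' ∧
      s'.realArr 0 = fun i j => if i < K ∧ j = m then s.realArr 0 i m -
        ∑ k ∈ Finset.range d, s.realArr 0 (R k) m * s.realArr 1 i k else s.realArr 0 i j) := by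
  refine (Spec.sweep (K := K) (d := d) hK hd
    (fun k i j => if i < K ∧ j = m then s.realArr 0 i m -
        ∑ k' ∈ Finset.range k, s.realArr 0 (R k') m * s.realArr 1 i k' else s.realArr 0 i j)
    (fun _ => m) (fun k => s.realArr 0 (R k) m)
    (fun k i => s.realArr 0 i m -
        ∑ k' ∈ Finset.range (k + 1), s.realArr 0 (R k') m * s.realArr 1 i k')
    ?_ ?_ ?_ ?_).mono (by
      simp only [RExpr.cost, NExpr.cost, coreRow]
      exact Nat.add_le_add_right (Nat.mul_le_mul_left _ (by omega)) _)
    fun _ h => h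
  · funext i j
    by_cases h : i < K ∧ j = m
    · simp [h]
    · simp [h]
  · intro k hk i j
    by_cases h : i < K ∧ j = m <;> simp [h]
  · intro k hk s' hF h7 ha
    have hrow' := hrow k hk
    simp only [RExpr.eval, NExpr.eval, coreRow, h7, hF.natArr, hF.nat 1 (by decide) (by decide),
      hF.nat 5 (by decide) (by decide), ha, hrow', hm, hR k hk, and_self, if_true]
    -- The coefficient is read from the partly reduced column, but by duality the earlier
    -- subtractions vanish at this pivot, so it is still the original entry.
    rw [Finset.sum_eq_zero, sub_zero]
    intro k' hk'
    have hk' := Finset.mem_range.1 hk'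
    rw [hdual k' (hk'.trans hk) k hk, if_neg hk'.ne, mul_zero]
  · intro k hk i hi s' hF h6 h7 h1 ha
    refine ⟨by simp [NExpr.eval, hF.nat 5, hm], ?_⟩
    simp only [RExpr.eval, NExpr.eval, h6, h7, h1, ha, hF.nat 5 (by decide) (by decide), hm,
      hF.realArr 1 (by decide), lt_irrefl, false_and, if_false, hi, true_and, if_true,
      Finset.sum_range_succ]
    ring

/-- Subtract multiples of column `4` of the array `1` from the preceding columns so that they vanish
in row `8`. -/
def clearRow : Prog :=
  sweep 1 (.arr 1 (.var 8) (.var 7)) (.var 7)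
    (.sub (.arr 1 (.var 6) (.var 7)) (.mul (.var 1) (.arr 1 (.var 6) (.var 4))))

theorem clearRow_spec {K d p : ℕ} {s : State} (hK : s.nat 3 = K) (hd : s.nat 4 = d)
    (hp : s.nat 8 = p) :
    Spec clearRow s (d * (K * 20 + 40) + 6) (fun s' => Frame 1 s s' ∧
      s'.realArr 1 = fun i j => if i < K ∧ j < d then
        s.realArr 1 i j - s.realArr 1 p j * s.realArr 1 i d else s.realArr 1 i j) := by
  refine (Spec.sweep (K := K) (d := d) hK hd
    (fun k i j => if i < K ∧ j < k then
        s.realArr 1 i j - s.realArr 1 p j * s.realArr 1 i d else s.realArr 1 i j)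
    (fun k => k) (fun k => s.realArr 1 p k)
    (fun k i => s.realArr 1 i k - s.realArr 1 p k * s.realArr 1 i d)
    ?_ ?_ ?_ ?_).mono (by
      simp only [RExpr.cost, NExpr.cost]
      exact Nat.add_le_add_right (Nat.mul_le_mul_left _ (by omega)) _)
    fun _ h => h
  · simp
  · intro k hk i j
    by_cases hi : i < K
    · rcases lt_trichotomy j k with h | rfl | h
      · simp [hi, h, h.ne, Nat.lt_succ_of_lt h]
      · simp [hi]
      · simp [hi, h.ne', h.not_gt, (show ¬ j < k + 1 by omega)]
    · simp [hi]
  · intro k hk s' hF h7 ha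
    simp [RExpr.eval, NExpr.eval, h7, hF.nat 8, hp, ha]
  · intro k hk i hi s' hF h6 h7 h1 ha
    refine ⟨by simp [NExpr.eval, h7], ?_⟩
    simp [RExpr.eval, NExpr.eval, h6, h7, h1, ha, hF.nat 4, hd, hk.ne', hk.not_gt]

/-- Process column `5` of the input. -/
def pivotStep : Prog :=
  .seq reduceColumn
  (.seq (argmax (.mul (.arr 0 (.var 6) (.var 5)) (.arr 0 (.var 6) (.var 5))))
  (.ite (.realLt (.ofNat (.lit 0)) (.var 0))
    (.seq (storeCol 1 (.var 4) (.div (.arr 0 (.var 6) (.var 5)) (.arr 0 (.var 8) (.var 5))))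
      (.seq clearRow (appendCore 4)))
    .skip))

/-- Compute a basis dual to pivots. -/
def pivotAll : Prog := forLoop 5 2 pivotStep

/-- The first `m` columns of the input `B` have been processed. -/
structure PivotInv {A Z : ℕ} (M : ℕ) (B : ℕ → ℕ → ℝ) (m d : ℕ) (r : ℕ → Fin A × Fin Z)
    (y : ℕ → Fin A × Fin Z → ℝ) (s : State) : Prop where
  nat1 : s.nat 1 = Z
  nat2 : s.nat 2 = M
  nat3 : s.nat 3 = A * Z
  nat4 : s.nat 4 = d
  nat5 : s.nat 5 = m
  le : d ≤ m
  core : CoreInv d r s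
  input : ∀ i, ∀ k, m ≤ k → s.realArr 0 i k = B i k
  basis : PivotBasis d (Submodule.span ℝ ((fun k q => B (rowIndex q) k) '' Set.Iio m)) r
    (fun j q => s.realArr 1 (rowIndex q) j) y
  zero : ∀ i j, d ≤ j → s.realArr 1 i j = 0

theorem pivotStep_spec {A Z M : ℕ} (hA : 1 ≤ A) (hZ : 1 ≤ Z) {B : ℕ → ℕ → ℝ} {m d : ℕ}
    {r : ℕ → Fin A × Fin Z} {y : ℕ → Fin A × Fin Z → ℝ} {s : State} (hm : m < M)
    (h : PivotInv M B m d r y s) :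
    Spec pivotStep s (M * (A * Z * 40 + 80) + A * Z * 60 + 100) (fun s' =>
      ∃ (d' : ℕ) (r' : ℕ → Fin A × Fin Z) (y' : ℕ → Fin A × Fin Z → ℝ),
        PivotInv M B (m + 1) d' r' y' (s'.setNat 5 (s'.nat 5 + 1))) := by
  have hK0 : 0 < A * Z := by positivity
  have hdM : d ≤ M := h.le.trans hm.le
  have hS : Submodule.span ℝ ((fun k (q : Fin A × Fin Z) => B (rowIndex q) k) '' Set.Iio (m + 1)) =
      Submodule.span ℝ ((fun k (q : Fin A × Fin Z) => B (rowIndex q) k) '' Set.Iio m) ⊔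
        Submodule.span ℝ {fun q => B (rowIndex q) m} := by
    rw [← Submodule.span_union]
    congr 1
    ext u
    simp only [Set.mem_image, Set.mem_Iio, Nat.lt_succ_iff_lt_or_eq, Set.mem_union,
      Set.mem_singleton_iff]
    constructor
    · rintro ⟨k, hk | rfl, rfl⟩
      · exact .inl ⟨k, hk, rfl⟩
      · exact .inr rfl
    · rintro (⟨k, hk, rfl⟩ | rfl)
      · exact ⟨k, .inl hk, rfl⟩
      · exact ⟨m, .inr rfl, rfl⟩
  have hmul : d * (A * Z * 20 + 40) ≤ M * (A * Z * 20 + 40) := Nat.mul_le_mul_right _ hdM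
  refine (Spec.seq (reduceColumn_spec (K := A * Z) (R := fun j => rowIndex (r j)) h.nat3 h.nat4
    h.nat5 (fun j _ => rowIndex_lt _)
    (fun j hj => by rw [(h.core.core j hj).1, (h.core.core j hj).2, h.nat1, rowIndex])
    (fun j hj k hk => h.basis.dual j hj k hk))
    (T' := M * (A * Z * 20 + 40) + A * Z * 60 + 90) ?_).mono (by ring_nf at hmul ⊢; omega)
    fun _ h => h
  rintro s1 ⟨hF1, h10⟩
  set b : Fin A × Fin Z → ℝ := fun q => B (rowIndex q) m with hb
  set x : ℕ → Fin A × Fin Z → ℝ := fun j q => s.realArr 1 (rowIndex q) j with hx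
  -- The residual after interpolation at the pivots: it vanishes there, and it is zero exactly when
  -- the new column is already in the span.
  set v : Fin A × Fin Z → ℝ := b - ∑ j ∈ Finset.range d, b (r j) • x j with hv
  have h10v : ∀ q, s1.realArr 0 (rowIndex q) m = v q := by
    intro q
    simp only [h10, rowIndex_lt q, true_and, if_true, h.input _ m le_rfl, hv, Pi.sub_apply,
      Finset.sum_apply, Pi.smul_apply, smul_eq_mul, hb, hx]
  have hdual : ∀ j < d, ∀ k < d, x j (r k) = if j = k then 1 else 0 := h.basis.dual
  have hvr : ∀ k < d, v (r k) = 0 := by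
    intro k hk
    simp only [hv, Pi.sub_apply, Finset.sum_apply, Pi.smul_apply, smul_eq_mul]
    rw [Finset.sum_eq_single_of_mem k (Finset.mem_range.2 hk)]
    · rw [hdual k hk k hk, if_pos rfl, mul_one, sub_self]
    · intro j hj hne
      rw [hdual j (Finset.mem_range.1 hj) k hk, if_neg hne, mul_zero]
  -- Squares replace absolute values, which are not a machine operation.
  refine (Spec.seq (Spec.argmax (K := A * Z) (by rw [hF1.nat 3 (by decide) (by decide), h.nat3]) hK0
    (fun i => s1.realArr 0 i m * s1.realArr 0 i m) (fun i hi s' hF h6 => by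
      simp [RExpr.eval, NExpr.eval, h6, hF.realArr, hF.nat 5, hF1.nat 5, h.nat5]))
    (T' := M * (A * Z * 20 + 40) + A * Z * 20 + 60) ?_).mono
    (by simp only [RExpr.cost, NExpr.cost]; ring_nf; omega) fun _ h => h
  rintro s2 ⟨hF2, hmax, hbest, h8, hatt⟩
  have hnat : ∀ y, y ≠ 6 → y ≠ 7 → y ≠ 8 → s2.nat y = s.nat y := fun y h6 h7 h8 => by
    rw [hF2.nat y h6 h8, hF1.nat y h6 h7]
  have hcore2 : CoreInv d r s2 := h.core.congr (hF2.natArr.trans hF1.natArr)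
  have hin2 : ∀ i k, m + 1 ≤ k → s2.realArr 0 i k = B i k := by
    intro i k hk
    rw [hF2.realArr, h10]
    simp only [show k ≠ m by omega, and_false, if_false]
    exact h.input i k (by omega)
  have h21 : s2.realArr 1 = s.realArr 1 := by rw [hF2.realArr, hF1.realArr 1 (by decide)]
  obtain ⟨q, hq⟩ := exists_rowIndex_eq h8
  refine (Spec.ite (T := M * (A * Z * 20 + 40) + A * Z * 20 + 50) (fun hpos => ?_)
    fun hpos => ?_).mono
    (by simp only [BExpr.cost, RExpr.cost, NExpr.cost]; omega) fun _ h => h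
  · simp only [BExpr.holds, RExpr.eval, NExpr.eval, Nat.cast_zero] at hpos
    have hatt' : v q * v q = s2.real 0 := by rw [← hatt hpos, ← hq, h10v]
    have hvq : v q ≠ 0 := by
      intro h0
      rw [h0, mul_zero] at hatt'
      exact hpos.ne hatt'
    -- Dividing by an entry of largest modulus bounds the new function by one.
    set z : Fin A × Fin Z → ℝ := (v q)⁻¹ • v with hz
    have hzle : ∀ q', |z q'| ≤ 1 := by
      intro q'
      have h1 := hmax (rowIndex q') (rowIndex_lt q')
      rw [h10v, ← hatt'] at h1
      have h2 := abs_le_iff_mul_self_le.2 h1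
      rw [hz, Pi.smul_apply, smul_eq_mul, abs_mul, abs_inv, ← div_eq_inv_mul]
      exact div_le_one_of_le₀ h2 (abs_nonneg _)
    refine (Spec.seq (Spec.storeCol (K := A * Z) (J := d) (by simp [hnat, h.nat3])
      (fun i => s2.realArr 0 i m / s2.realArr 0 (rowIndex q) m) (fun i hi s' hF h6 _ _ _ => by
        simp [RExpr.eval, NExpr.eval, h6, hF.realArr 0, hF.nat 5, hF.nat 4, hF.nat 8, hnat, hq,
          h.nat5, h.nat4]))
      (T' := M * (A * Z * 20 + 40) + 40) ?_).mono
      (by simp only [RExpr.cost, NExpr.cost]; ring_nf; omega) fun _ h => h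
    rintro s3 ⟨hF3, -, -, h31⟩
    refine (Spec.seq (clearRow_spec (K := A * Z) (d := d) (p := rowIndex q)
      (by simp [hF3.nat 3, hnat, h.nat3]) (by simp [hF3.nat 4, hnat, h.nat4])
      (by simp [hF3.nat 8, hq])) (T' := 27) ?_).mono
      (by ring_nf at hmul ⊢; omega) fun _ h => h
    rintro s4 ⟨hF4, h41⟩
    have hF := hF3.trans hF4
    refine (appendCore_spec (hcore2.congr hF.natArr) (by simp [hF.nat 4, hnat, h.nat4])
      q (by simp [hF.nat 8, hq])).mono le_rfl ?_
    rintro s5 ⟨hcore5, hr5, hra5, h54, hn5⟩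
    have hx5 : ∀ q' j, s5.realArr 1 (rowIndex q') j =
        if j < d then x j q' - x j q * z q' else if j = d then z q' else 0 := by
      intro q' j
      have hcol : ∀ q'', s2.realArr 0 (rowIndex q'') m / s2.realArr 0 (rowIndex q) m = z q'' := by
        intro q''
        rw [hF2.realArr, h10v, h10v, hz, Pi.smul_apply, smul_eq_mul, div_eq_inv_mul]
      rw [hra5, h41]
      simp only [rowIndex_lt, true_and, h31, h21, hcol, if_true]
      rcases lt_trichotomy j d with hj | rfl | hj
      · simp [hj, hj.ne, hx]
      · simp
      · simp [hj.ne', hj.not_gt, h.zero _ _ hj.le]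
    refine ⟨d + 1, Function.update r d q, Function.update y d z, ?_, ?_, ?_, ?_, ?_,
      Nat.succ_le_succ h.le, hcore5.congr rfl, ?_, ?_, ?_⟩
    · simp [hn5, hF.nat 1, hnat, h.nat1]
    · simp [hn5, hF.nat 2, hnat, h.nat2]
    · simp [hn5, hF.nat 3, hnat, h.nat3]
    · simpa using h54
    · simp [hn5, hF.nat 5, hnat, h.nat5]
    · intro i k hk
      rw [setNat_realArr, hra5, hF.realArr 0 (by decide)]
      exact hin2 i k hk
    · refine h.basis.insert (q := q) (z := z) ?_ ?_ hzle ?_ ?_ ?_ ?_ ?_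
      · simp [hz, hvq]
      · intro k hk
        simp [hz, hvr k hk]
      · intro j hj
        simp [hj.ne]
      · simp
      · intro j hj
        funext q'
        simp [hx5, hj, hx]
      · funext q'
        simp [hx5]
      · rw [hS]
        have hsum := h.basis.sum_mem fun j => b (r j)
        apply le_antisymm
        · refine sup_le le_sup_left ?_
          rw [Submodule.span_singleton_le_iff_mem]
          have : b = (∑ j ∈ Finset.range d, b (r j) • x j) + v q • z := by
            rw [hz, smul_smul, mul_inv_cancel₀ hvq, one_smul, hv, add_sub_cancel]
          rw [this]
          exact Submodule.add_mem _ (Submodule.mem_sup_left hsum) (Submodule.smul_mem _ _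
            (Submodule.mem_sup_right (Submodule.mem_span_singleton_self z)))
        · refine sup_le le_sup_left ?_
          rw [Submodule.span_singleton_le_iff_mem, hz, hv]
          exact Submodule.smul_mem _ _ (Submodule.sub_mem _
            (Submodule.mem_sup_right (Submodule.mem_span_singleton_self b))
            (Submodule.mem_sup_left hsum))
    · intro i j hj
      rw [setNat_realArr, hra5, h41]
      simp [show ¬ j < d by omega, h31, show j ≠ d by omega, h21, h.zero i j (by omega)]
  · simp only [BExpr.holds, RExpr.eval, NExpr.eval, Nat.cast_zero] at hpos
    have hv0 : v = 0 := by
      funext q'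
      have h1 := hmax (rowIndex q') (rowIndex_lt q')
      rw [h10v] at h1
      exact mul_self_eq_zero.1 (le_antisymm (by linarith) (mul_self_nonneg _))
    refine (Spec.skip ?_).mono (by omega) fun _ h => h
    refine ⟨d, r, y, ?_, ?_, ?_, ?_, ?_, h.le.trans (Nat.le_succ m), hcore2.congr rfl, ?_, ?_, ?_⟩
    · simp [hnat, h.nat1]
    · simp [hnat, h.nat2]
    · simp [hnat, h.nat3]
    · simp [hnat, h.nat4]
    · simp [hnat, h.nat5]
    · exact hin2
    · refine h.basis.congr (fun _ _ => rfl) (fun j hj => by simp [h21]) ?_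
      rw [hS, sup_eq_left, Submodule.span_singleton_le_iff_mem]
      have : b = ∑ j ∈ Finset.range d, b (r j) • x j := sub_eq_zero.1 hv0
      change b ∈ _
      rw [this]
      exact h.basis.sum_mem fun j => b (r j)
    · intro i j hj
      rw [setNat_realArr, h21]
      exact h.zero i j hj

theorem pivotAll_spec {A Z M : ℕ} (hA : 1 ≤ A) (hZ : 1 ≤ Z) {s : State}
    (h1 : s.nat 1 = Z) (h2 : s.nat 2 = M) (h3 : s.nat 3 = A * Z) (h4 : s.nat 4 = 0)
    (htab : ∀ q : Fin A × Fin Z,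
      s.natArr 1 (rowIndex q) 0 = q.1 ∧ s.natArr 1 (rowIndex q) 1 = q.2)
    (hflag : ∀ i, s.natArr 2 i 0 = 0) (hzero : ∀ i j, s.realArr 1 i j = 0) :
    Spec pivotAll s (M * (M * (A * Z * 40 + 80) + A * Z * 60 + 108) + 6) (fun s' =>
      ∃ (d : ℕ) (r : ℕ → Fin A × Fin Z) (y : ℕ → Fin A × Fin Z → ℝ),
        PivotInv M (s.realArr 0) M d r y s') := by
  have q0 : Fin A × Fin Z := ⟨⟨0, hA⟩, ⟨0, hZ⟩⟩
  refine (Spec.forLoop (N := M) (fun m s' => ∃ (d : ℕ) (r : ℕ → Fin A × Fin Z)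
    (y : ℕ → Fin A × Fin Z → ℝ), PivotInv M (s.realArr 0) m d r y s') ?_ ?_ ?_ ?_).mono
    le_rfl fun _ h => h
  · rintro k s' ⟨d, r, y, h⟩
    exact h.nat5
  · rintro k s' ⟨d, r, y, h⟩
    exact h.nat2
  · refine ⟨0, fun _ => q0, fun _ _ => 0, by simp [h1], by simp [h2], by simp [h3], by simp [h4],
      by simp, le_rfl, ⟨htab, by simp, fun q => by simp [hflag]⟩, fun _ _ _ => rfl, ?_,
      fun i j _ => hzero i j⟩
    have := PivotBasis.zero (fun _ => q0) (fun j q => s.realArr 1 (rowIndex q) j) (fun _ _ => 0)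
    refine this.congr (fun _ _ => rfl) (fun _ _ => rfl) (by simp)
  · rintro k hk s' ⟨d, r, y, h⟩
    exact pivotStep_spec hA hZ hk h

end RealRAM

-- Take `C j k = y j (r k)`. Interpolation turns `C *ᵥ x(q)` into the vector of the `y j q`, each of
-- modulus at most one; `C` is upper triangular with unit diagonal.
open Matrix in
theorem PivotBasis.exists_unimodular {ι : Type*} {d : ℕ} {S : Submodule ℝ (ι → ℝ)} {r : ℕ → ι}
    {x y : ℕ → ι → ℝ} (h : PivotBasis d S r x y) :
    ∃ C : Matrix (Fin d) (Fin d) ℝ, C.det = 1 ∧ ∀ q,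
      (C *ᵥ fun j : Fin d => x j q) ⬝ᵥ (C *ᵥ fun j : Fin d => x j q) ≤ d := by
  refine ⟨Matrix.of fun j k : Fin d => y j (r k), ?_, fun q => ?_⟩
  · have ht : (Matrix.of fun j k : Fin d => y j (r k)).IsUpperTriangular :=
      fun j k hjk => h.lower j j.2 k hjk
    rw [det_of_isUpperTriangular ht]
    exact Finset.prod_eq_one fun j _ => h.diag j j.2
  · have hy : ∀ j : Fin d,
        ((Matrix.of fun j k : Fin d => y j (r k)) *ᵥ fun j : Fin d => x j q) j = y j q := by
      intro j
      have := congrFun (h.eq_sum (h.mem j j.2)) q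
      rw [this, Finset.sum_apply, ← Fin.sum_univ_eq_sum_range (fun k => (y j (r k) • x k) q)]
      rfl
    simp only [dotProduct, hy]
    calc ∑ j : Fin d, y j q * y j q ≤ ∑ j : Fin d, (1 : ℝ) := by
          refine Finset.sum_le_sum fun j _ => ?_
          have := h.abs_le j j.2 q
          rw [← abs_mul_abs_self]
          nlinarith [abs_nonneg (y j q)]
      _ = d := by simp

/-! ### Machine routines for leverages and rank-one updates. -/

namespace RealRAM

/-- Put the sums over the values of variable `7` below variable `4` of the values of `e` into
column `0` of the array `3`. -/
def accumulate (c e : RExpr) : Prog :=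
  .seq (storeCol 3 (.lit 0) (.ofNat (.lit 0)))
    (sweep 3 c (.lit 0) (.add (.arr 3 (.var 6) (.lit 0)) e))

theorem accumulate_spec {K d : ℕ} {c e : RExpr} {s : State} (hK : s.nat 3 = K)
    (hd : s.nat 4 = d) (cv : ℕ → ℝ) (f : ℕ → ℕ → ℝ)
    (hc : ∀ k < d, ∀ s', Frame 3 s s' → s'.nat 7 = k → c.eval s' = cv k)
    (he : ∀ k < d, ∀ i < K, ∀ s', Frame 3 s s' → s'.nat 6 = i → s'.nat 7 = k →
      s'.real 1 = cv k → e.eval s' = f k i) :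
    Spec (accumulate c e) s (d * (c.cost + K * (e.cost + 15) + 15) + K * 13 + 12) (fun s' =>
      Frame 3 s s' ∧ ∀ i < K, s'.realArr 3 i 0 = ∑ k ∈ Finset.range d, f k i) := by
  refine (Spec.seq (Spec.storeCol (K := K) (J := 0) hK (fun _ => 0) ?_)
    (T' := d * (c.cost + (K * (e.cost + 15)) + 15) + 6) ?_).mono ?_ fun _ h => h
  · intro i hi s' _ _ _ _ _
    simp [RExpr.eval, NExpr.eval]
  · rintro s1 ⟨hF1, -, -, h31⟩
    refine (Spec.sweep (K := K) (d := d) (by simp [hF1.nat 3, hK]) (by simp [hF1.nat 4, hd])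
      (fun k i j => if i < K ∧ j = 0 then ∑ k' ∈ Finset.range k, f k' i else s.realArr 3 i j)
      (fun _ => 0) cv (fun k i => ∑ k' ∈ Finset.range (k + 1), f k' i) ?_ ?_ ?_ ?_).mono ?_ ?_
    · simp [h31]
    · intro k hk i j
      by_cases h : i < K ∧ j = 0 <;> simp [h]
    · intro k hk s' hF h7 _
      exact hc k hk s' (hF1.trans hF) h7
    · intro k hk i hi s' hF h6 h7 h1 ha
      refine ⟨rfl, ?_⟩
      have := he k hk i hi s' (hF1.trans hF) h6 h7 h1
      simp only [RExpr.eval, NExpr.eval, this, h6, ha, lt_irrefl, false_and, if_false, hi, true_and,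
        if_true, Finset.sum_range_succ]
    · simp only [RExpr.cost, NExpr.cost]
      exact Nat.add_le_add_right (Nat.mul_le_mul_left _ (Nat.add_le_add_right
        (Nat.add_le_add_left (Nat.mul_le_mul_left _ (by omega)) _) _)) _
    · rintro s' ⟨hF, ha⟩
      refine ⟨hF1.trans hF, fun i hi => ?_⟩
      rw [ha]
      simp [hi]
  · simp only [RExpr.cost, NExpr.cost]
    omega

/-- Copy the basis from the array `1` to the array `2`. -/
def copyBasis : Prog :=
  sweep 2 (.ofNat (.lit 0)) (.var 7) (.arr 1 (.var 6) (.var 7))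

theorem copyBasis_spec {K d : ℕ} {s : State} (hK : s.nat 3 = K) (hd : s.nat 4 = d) :
    Spec copyBasis s (d * (K * 14 + 17) + 6) (fun s' => Frame 2 s s' ∧
      ∀ i < K, ∀ j < d, s'.realArr 2 i j = s.realArr 1 i j) := by
  refine (Spec.sweep (K := K) (d := d) hK hd
    (fun k i j => if i < K ∧ j < k then s.realArr 1 i j else s.realArr 2 i j)
    (fun k => k) (fun k => 0) (fun k i => s.realArr 1 i k) ?_ ?_ ?_ ?_).mono ?_ ?_
  · simp
  · intro k hk i j
    by_cases hi : i < K
    · rcases lt_trichotomy j k with h | rfl | h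
      · simp [hi, h, h.ne, Nat.lt_succ_of_lt h]
      · simp [hi]
      · simp [hi, h.ne', h.not_gt, (show ¬ j < k + 1 by omega)]
    · simp [hi]
  · intro k hk s' hF h7 ha
    simp [RExpr.eval, NExpr.eval]
  · intro k hk i hi s' hF h6 h7 h1 ha
    simp [RExpr.eval, NExpr.eval, h6, h7, hF.realArr 1]
  · simp only [RExpr.cost, NExpr.cost]
    exact Nat.add_le_add_right (Nat.mul_le_mul_left _ (by omega)) _
  · rintro s' ⟨hF, ha⟩
    refine ⟨hF, fun i hi j hj => ?_⟩
    rw [ha]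
    simp [hi, hj]

/-- Compute the leverages of the rows and their maximum. -/
def leverages : Prog :=
  .seq (accumulate (.ofNat (.lit 0)) (.mul (.arr 1 (.var 6) (.var 7)) (.arr 2 (.var 6) (.var 7))))
    (argmax (.arr 3 (.var 6) (.lit 0)))

theorem leverages_spec {K d : ℕ} {s : State} (hK : s.nat 3 = K) (hK0 : 0 < K) (hd : s.nat 4 = d) :
    Spec leverages s (d * (K * 22 + 17) + K * 34 + 24) (fun s' =>
      (∀ x, x ≠ 6 → x ≠ 7 → x ≠ 8 → s'.nat x = s.nat x) ∧
      (∀ x, x ≠ 0 → x ≠ 1 → s'.real x = s.real x) ∧ s'.natArr = s.natArr ∧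
      (∀ b, b ≠ 3 → s'.realArr b = s.realArr b) ∧
      (∀ i < K, ∑ k ∈ Finset.range d, s.realArr 1 i k * s.realArr 2 i k ≤ s'.real 0) ∧
      0 ≤ s'.real 0 ∧ s'.nat 8 < K ∧ (0 < s'.real 0 →
        ∑ k ∈ Finset.range d, s.realArr 1 (s'.nat 8) k * s.realArr 2 (s'.nat 8) k =
          s'.real 0)) := by
  refine (Spec.seq (accumulate_spec (K := K) (d := d) hK hd (fun _ => 0)
    (fun k i => s.realArr 1 i k * s.realArr 2 i k) ?_ ?_) (T' := K * 21 + 12) ?_).mono ?_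
    fun _ h => h
  · intro k hk s' hF h7
    simp [RExpr.eval, NExpr.eval]
  · intro k hk i hi s' hF h6 h7 h1
    simp [RExpr.eval, NExpr.eval, h6, h7, hF.realArr]
  · rintro s1 ⟨hF1, h31⟩
    refine (Spec.argmax (K := K) (by simp [hF1.nat 3, hK]) hK0
      (fun i => ∑ k ∈ Finset.range d, s.realArr 1 i k * s.realArr 2 i k) ?_).mono ?_ ?_
    · intro i hi s' hF h6
      simp [RExpr.eval, NExpr.eval, h6, hF.realArr, h31 i hi]
    · simp only [RExpr.cost, NExpr.cost]
      omega
    · rintro s2 ⟨hF2, hmax, h0, h8, hatt⟩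
      exact ⟨fun x h6 h7 h8 => by rw [hF2.nat x h6 h8, hF1.nat x h6 h7],
        fun x h0 h1 => by rw [hF2.real x h0, hF1.real x h1], by rw [hF2.natArr, hF1.natArr],
        fun b hb => by rw [hF2.realArr, hF1.realArr b hb], hmax, h0, h8, hatt⟩
  · simp only [RExpr.cost, NExpr.cost]
    ring_nf
    omega

/-- Add weight to row `8` and update the array `2` accordingly. -/
def addWeight : Prog :=
  .seq (accumulate (.arr 2 (.var 8) (.var 7)) (.mul (.arr 1 (.var 6) (.var 7)) (.var 1)))
  (.seq (.setReal 3 (.div (.var 2) (.ofNat (.var 4))))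
  (.seq (sweep 2 (.mul (.arr 2 (.var 8) (.var 7))
      (.div (.var 3) (.add (.ofNat (.lit 1)) (.mul (.var 3) (.var 0))))) (.var 7)
      (.sub (.arr 2 (.var 6) (.var 7)) (.mul (.arr 3 (.var 6) (.lit 0)) (.var 1))))
  (.setReal 2 (.add (.var 2) (.var 3)))))

/-- All products of basis rows with the solution at row `p` are saved in array `3` before array `2`,
which contains that solution, is overwritten. This keeps the update at `O(K d)` operations. -/
theorem addWeight_spec {K d p : ℕ} {s : State} (hK : s.nat 3 = K) (hd : s.nat 4 = d)
    (hp : s.nat 8 = p) :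
    Spec addWeight s (d * (K * 45 + 60) + K * 13 + 40) (fun s' =>
      (∀ x, x ≠ 6 → x ≠ 7 → s'.nat x = s.nat x) ∧ s'.natArr = s.natArr ∧
      s'.realArr 1 = s.realArr 1 ∧ s'.real 2 = s.real 2 + s.real 2 / d ∧
      ∀ i < K, ∀ j < d, s'.realArr 2 i j = s.realArr 2 i j -
        (∑ k ∈ Finset.range d, s.realArr 1 i k * s.realArr 2 p k) *
          (s.realArr 2 p j * (s.real 2 / d / (1 + s.real 2 / d * s.real 0)))) := by
  refine (Spec.seq (accumulate_spec (K := K) (d := d) hK hd (fun k => s.realArr 2 p k)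
    (fun k i => s.realArr 1 i k * s.realArr 2 p k) ?_ ?_)
    (T' := d * (K * 20 + 40) + 20) ?_).mono ?_ fun _ h => h
  · intro k hk s' hF h7
    simp [RExpr.eval, NExpr.eval, h7, hF.nat 8, hp, hF.realArr 2]
  · intro k hk i hi s' hF h6 h7 h1
    simp [RExpr.eval, NExpr.eval, h6, h7, hF.realArr 1, h1]
  · rintro s1 ⟨hF1, h31⟩
    refine (Spec.seq (Spec.setReal (Q := fun t => t = s1.setReal 3 (s.real 2 / d))
      (by simp [RExpr.eval, NExpr.eval, hF1.real 2, hF1.nat 4, hd]))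
      (T' := d * (K * 20 + 40) + 12) ?_).mono
      (by simp only [RExpr.cost, NExpr.cost]; omega) fun _ h => h
    rintro s2 rfl
    refine (Spec.seq (Spec.sweep (K := K) (d := d) (by simp [hF1.nat 3, hK])
      (by simp [hF1.nat 4, hd])
      (fun k i j => if i < K ∧ j < k then s.realArr 2 i j -
        (∑ k ∈ Finset.range d, s.realArr 1 i k * s.realArr 2 p k) *
          (s.realArr 2 p j * (s.real 2 / d / (1 + s.real 2 / d * s.real 0)))
        else s.realArr 2 i j)
      (fun k => k) (fun k => s.realArr 2 p k * (s.real 2 / d / (1 + s.real 2 / d * s.real 0)))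
      (fun k i => s.realArr 2 i k -
        (∑ k ∈ Finset.range d, s.realArr 1 i k * s.realArr 2 p k) *
          (s.realArr 2 p k * (s.real 2 / d / (1 + s.real 2 / d * s.real 0)))) ?_ ?_ ?_ ?_)
      (T' := 4) ?_).mono ?_ fun _ h => h
    · simp [hF1.realArr 2]
    · intro k hk i j
      by_cases hi : i < K
      · rcases lt_trichotomy j k with h | rfl | h
        · simp [hi, h, h.ne, Nat.lt_succ_of_lt h]
        · simp [hi]
        · simp [hi, h.ne', h.not_gt, (show ¬ j < k + 1 by omega)]
      · simp [hi]
    · intro k hk s' hF h7 ha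
      simp [RExpr.eval, NExpr.eval, h7, hF.nat 8, hF1.nat 8, hp, ha, hF.real 3, hF.real 0,
        hF1.real 0]
    · intro k hk i hi s' hF h6 h7 h1 ha
      refine ⟨h7, ?_⟩
      simp [RExpr.eval, NExpr.eval, h6, h7, h1, ha, hF.realArr 3, h31 i hi]
    · rintro s3 ⟨hF3, h32⟩
      refine (Spec.setReal ?_).mono (by simp only [RExpr.cost]; omega) fun _ h => h
      refine ⟨fun x h6 h7 => by simp [hF3.nat x h6 h7, hF1.nat x h6 h7],
        by simp [hF3.natArr, hF1.natArr], by simp [hF3.realArr 1, hF1.realArr 1],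
        by simp [RExpr.eval, hF3.real 2, hF3.real 3, hF1.real 2], fun i hi j hj => ?_⟩
      rw [setReal_realArr, h32]
      simp [hi, hj]
    · simp only [RExpr.cost, NExpr.cost]
      ring_nf
      omega
  · simp only [RExpr.cost, NExpr.cost]
    ring_nf
    omega

end RealRAM

/-! ### The greedy design iteration. -/

namespace RealRAM

open Matrix

/-- The coordinates of the rows. -/
def rowVec {A Z : ℕ} (d : ℕ) (X : ℕ → ℕ → ℝ) (q : Fin A × Fin Z) : Fin d → ℝ :=
  fun j => X (rowIndex q) j

theorem rowVec_dotProduct {A Z d : ℕ} (X Y : ℕ → ℕ → ℝ) (q q' : Fin A × Fin Z) :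
    rowVec d X q ⬝ᵥ rowVec d Y q' =
      ∑ k ∈ Finset.range d, X (rowIndex q) k * Y (rowIndex q') k :=
  Fin.sum_univ_eq_sum_range (fun k => X (rowIndex q) k * Y (rowIndex q') k) d

/-- After `k` steps the memory represents the design `w` supported at the core pairs
`r 0, …, r (n - 1)`, and the gap of the design is under control. -/
structure DesignInv {A Z : ℕ} (d : ℕ) (X : ℕ → ℕ → ℝ) (k n : ℕ) (r : ℕ → Fin A × Fin Z)
    (w : Fin A × Fin Z → ℝ) (s : State) : Prop where
  nat3 : s.nat 3 = A * Z
  nat4 : s.nat 4 = d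
  nat9 : s.nat 9 = n
  basis : s.realArr 1 = X
  weight : s.real 2 = ∑ q, w q
  nonneg : ∀ q, 0 ≤ w q
  support : ∀ q, w q ≠ 0 → ∃ j < n, r j = q
  core : CoreInv n r s
  injOn : ∀ i < n, ∀ j < n, r i = r j → i = j
  pos : (designGram (rowVec d X) w).PosDef
  sol : ∀ q : Fin A × Fin Z, designGram (rowVec d X) w *ᵥ rowVec d (s.realArr 2) q = rowVec d X q
  card_le : n ≤ d + k
  steps : d = 0 → k = 0
  le_weight : (d : ℝ) ≤ ∑ q, w q
  gap : 0 < d → k + stepBound d (designGap (rowVec d X) w) ≤ stepBound d (d * Real.log d)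

/-- The real variable `0` and the variable `8` hold the maximal leverage and its row. -/
structure LeverageInv (A Z d : ℕ) (X : ℕ → ℕ → ℝ) (s : State) : Prop where
  le : ∀ q : Fin A × Fin Z, rowVec d X q ⬝ᵥ rowVec d (s.realArr 2) q ≤ s.real 0
  nonneg : 0 ≤ s.real 0
  attained : ∃ p : Fin A × Fin Z, s.nat 8 = rowIndex p ∧
    (0 < s.real 0 → rowVec d X p ⬝ᵥ rowVec d (s.realArr 2) p = s.real 0)

theorem DesignInv.leverages {A Z d k n : ℕ} (hA : 1 ≤ A) (hZ : 1 ≤ Z) {X : ℕ → ℕ → ℝ}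
    {r : ℕ → Fin A × Fin Z} {w : Fin A × Fin Z → ℝ} {s : State} (h : DesignInv d X k n r w s) :
    Spec leverages s (d * (A * Z * 22 + 17) + A * Z * 34 + 24) (fun s' =>
      DesignInv d X k n r w s' ∧ LeverageInv A Z d X s') := by
  refine (leverages_spec h.nat3 (by positivity) h.nat4).mono le_rfl ?_
  rintro s' ⟨hn, hr, hna, hra, hmax, h0, h8, hatt⟩
  have h2 := hra 2 (by decide)
  refine ⟨⟨by simp [hn, h.nat3], by simp [hn, h.nat4], by simp [hn, h.nat9],
    by rw [hra 1 (by decide), h.basis], by rw [hr 2 (by decide) (by decide), h.weight], h.nonneg,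
    h.support, h.core.congr hna, h.injOn, h.pos, by rw [h2]; exact h.sol, h.card_le, h.steps,
    h.le_weight, h.gap⟩, fun q => ?_, h0, ?_⟩
  · rw [h2, rowVec_dotProduct, ← h.basis]
    exact hmax _ (rowIndex_lt q)
  · obtain ⟨p, hp⟩ := exists_rowIndex_eq h8
    refine ⟨p, hp.symm, fun hpos => ?_⟩
    rw [h2, rowVec_dotProduct, ← h.basis, hp]
    exact hatt hpos

/-- The test whether the design is not nearly optimal yet. -/
def improvable : BExpr :=
  .realLt (.mul (.ofNat (.lit 8)) (.ofNat (.var 4))) (.mul (.var 0) (.var 2))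

/-- Add weight to the row of maximal leverage, and add it to the core pairs. -/
def improve : Prog :=
  .seq addWeight (.ite (.natLt (.arr 2 (.var 8) (.lit 0)) (.lit 1)) (appendCore 9) .skip)

theorem DesignInv.improvable_iff {A Z d k n : ℕ} {X : ℕ → ℕ → ℝ} {r : ℕ → Fin A × Fin Z}
    {w : Fin A × Fin Z → ℝ} {s : State} (h : DesignInv d X k n r w s) :
    improvable.holds s ↔ 8 * (d : ℝ) < s.real 0 * ∑ q, w q := by
  simp [improvable, BExpr.holds, RExpr.eval, NExpr.eval, h.nat4, h.weight]

/-- For `d = 0` all leverages are empty sums, so the loop is never entered. -/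
theorem DesignInv.pos_of_improvable {A Z d k n : ℕ} {X : ℕ → ℕ → ℝ} {r : ℕ → Fin A × Fin Z}
    {w : Fin A × Fin Z → ℝ} {s : State} (h : DesignInv d X k n r w s)
    (hL : LeverageInv A Z d X s) (hb : improvable.holds s) : 0 < d ∧ 0 < s.real 0 := by
  rw [h.improvable_iff] at hb
  have h0 : 0 < s.real 0 := by
    refine lt_of_le_of_ne hL.nonneg fun h0 => ?_
    rw [← h0, zero_mul] at hb
    exact absurd hb (not_lt.2 (by positivity))
  refine ⟨Nat.pos_of_ne_zero ?_, h0⟩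
  rintro rfl
  obtain ⟨p, -, hp⟩ := hL.attained
  have := hp h0
  rw [rowVec_dotProduct, Finset.range_zero, Finset.sum_empty] at this
  exact h0.ne this

/-- A row chosen again gains weight but is not appended, so the core pairs stay distinct and their
number grows by at most one. The fall of `stepBound` by one pays for the increment of `k`. -/
theorem DesignInv.improve {A Z d k n : ℕ} {X : ℕ → ℕ → ℝ} {r : ℕ → Fin A × Fin Z}
    {w : Fin A × Fin Z → ℝ} {s : State} (h : DesignInv d X k n r w s)
    (hL : LeverageInv A Z d X s) (hb : improvable.holds s) :
    Spec improve s (d * (A * Z * 45 + 60) + A * Z * 13 + 73) (fun s' =>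
      ∃ (n' : ℕ) (r' : ℕ → Fin A × Fin Z) (w' : Fin A × Fin Z → ℝ),
        n ≤ n' ∧ (∀ j < n, r' j = r j) ∧ DesignInv d X (k + 1) n' r' w' s') := by
  obtain ⟨hd, h0⟩ := h.pos_of_improvable hL hb
  rw [h.improvable_iff] at hb
  obtain ⟨p, h8, hp⟩ := hL.attained
  have hp := hp h0
  have hd' : (0 : ℝ) < d := by positivity
  have hW : 0 < ∑ q, w q := hd'.trans_le h.le_weight
  set W := ∑ q, w q with hWdef
  set w' : Fin A × Fin Z → ℝ := fun q => w q + if q = p then W / d else 0 with hw'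
  have hgram : designGram (rowVec d X) w' = designGram (rowVec d X) w +
      (W / d) • vecMulVec (rowVec d X p) (rowVec d X p) := designGram_add_single _ _ _ _
  have hw'0 : ∀ q, 0 ≤ w' q := fun q => add_nonneg (h.nonneg q) (by split_ifs <;> positivity)
  have hsum : ∑ q, w' q = W + W / d := by
    rw [hw', Finset.sum_add_distrib, Finset.sum_ite_eq' Finset.univ p,
      if_pos (Finset.mem_univ p)]
  have hpos' : (designGram (rowVec d X) w').PosDef := by
    rw [hgram]
    exact h.pos.add_posSemidef (posSemidef_smul_vecMulVec (by positivity) _)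
  have hgap : designGap (rowVec d X) w' ≤ designGap (rowVec d X) w -
      max 1 (designGap (rowVec d X) w / d - 1) := by
    refine designGap_add_single hd (rowVec d X) (rowVec d (s.realArr 2)) h.nonneg hW h.pos p h.sol
      (fun q => ?_) ?_
    · rw [hp]
      exact hL.le q
    · rw [hp]
      exact hb
  refine (Spec.seq (addWeight_spec (K := A * Z) (d := d) (p := rowIndex p) h.nat3 h.nat4 h8)
    (T' := 33) ?_).mono (by omega) fun _ h => h
  rintro s1 ⟨hn, hna, hr1, hr2, hV⟩
  have hsol : ∀ q : Fin A × Fin Z,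
      designGram (rowVec d X) w' *ᵥ rowVec d (s1.realArr 2) q = rowVec d X q := by
    intro q
    have := designGram_update_mulVec (designGram (rowVec d X) w) (designGram_transpose _ _)
      (rowVec d X p) (rowVec d (s.realArr 2) p) (rowVec d X q) (rowVec d (s.realArr 2) q) (W / d)
      (h.sol p) (h.sol q) (by rw [hp]; positivity)
    rw [← hgram] at this
    rw [← this]
    congr 1
    funext j
    simp only [rowVec, Pi.sub_apply, Pi.smul_apply, smul_eq_mul]
    rw [hV _ (rowIndex_lt q) j j.2, ← rowVec_dotProduct, h.basis, h.weight, hp]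
    ring
  have hcore1 : CoreInv n r s1 := h.core.congr hna
  have hle : (d : ℝ) ≤ ∑ q, w' q := by
    rw [hsum]
    have : 0 ≤ W / d := by positivity
    linarith [h.le_weight]
  have hgap' : 0 < d → ((k + 1 : ℕ) : ℝ) + stepBound d (designGap (rowVec d X) w') ≤
      stepBound d (d * Real.log d) := by
    intro hd
    have := stepBound_add_one_le hd hgap
    push_cast
    linarith [h.gap hd]
  refine (Spec.ite (T := 27) (fun hb => ?_) fun hb => ?_).mono
    (by simp only [BExpr.cost, NExpr.cost]; omega) fun _ h => h
  · have hflag : ∀ j < n, r j ≠ p := by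
      rw [← hcore1.flag p]
      simpa [BExpr.holds, NExpr.eval, hn, h8] using hb
    refine (appendCore_spec hcore1 (by simp [hn, h.nat9]) p (by simp [hn, h8])).mono le_rfl ?_
    rintro s2 ⟨hcore2, hr, hra, h9, hn2⟩
    have hr' : ∀ j < n, Function.update r n p j = r j := fun j hj => by simp [hj.ne]
    refine ⟨n + 1, Function.update r n p, w', Nat.le_succ n, hr', by simp [hn2, hn, h.nat3],
      by simp [hn2, hn, h.nat4], h9, by rw [hra, hr1, h.basis], by rw [hr, hr2, hsum, h.weight],
      hw'0, ?_, hcore2, ?_, hpos', by rw [hra]; exact hsol, by have := h.card_le; omega,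
      fun h0 => absurd h0 hd.ne', hle, hgap'⟩
    · intro q hq
      by_cases hqp : q = p
      · exact ⟨n, Nat.lt_succ_self n, by simp [hqp]⟩
      · obtain ⟨j, hj, rfl⟩ := h.support q (by simpa [hw', hqp] using hq)
        exact ⟨j, Nat.lt_succ_of_lt hj, hr' j hj⟩
    · intro i hi j hj hij
      rcases Nat.lt_succ_iff_lt_or_eq.1 hi with hi | rfl <;>
        rcases Nat.lt_succ_iff_lt_or_eq.1 hj with hj | rfl
      · rw [hr' i hi, hr' j hj] at hij
        exact h.injOn i hi j hj hij
      · rw [hr' i hi, Function.update_self] at hij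
        exact absurd hij (hflag i hi)
      · rw [hr' j hj, Function.update_self] at hij
        exact absurd hij.symm (hflag j hj)
      · rfl
  · have hflag : ∃ j < n, r j = p := by
      have : ¬ s1.natArr 2 (rowIndex p) 0 = 0 := by
        simpa [BExpr.holds, NExpr.eval, hn, h8] using hb
      rw [hcore1.flag p] at this
      push Not at this
      exact this
    refine (Spec.skip ?_).mono (by omega) fun _ h => h
    refine ⟨n, r, w', le_rfl, fun _ _ => rfl, by simp [hn, h.nat3],
      by simp [hn, h.nat4], by simp [hn, h.nat9], by rw [hr1, h.basis], by rw [hr2, hsum, h.weight],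
      hw'0, ?_, hcore1, h.injOn, hpos', hsol, by have := h.card_le; omega,
      fun h0 => absurd h0 hd.ne', hle, hgap'⟩
    intro q hq
    by_cases hqp : q = p
    · exact hqp ▸ hflag
    · exact h.support q (by simpa [hw', hqp] using hq)

/-- Compute a nearly optimal design, starting with a basis. -/
def designAll : Prog :=
  .seq copyBasis (.seq (.setNat 9 (.var 4)) (.seq (.setReal 2 (.ofNat (.var 4)))
    (.seq leverages (.seq (.loop improvable (.seq improve leverages)) (.setNat 0 (.var 9))))))

/-- A bound for the number of steps of `designAll`. -/
noncomputable def designSteps (d : ℕ) : ℕ := ⌊stepBound d (d * Real.log d)⌋₊ + 1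

/-- `DesignInv` for some extension of the initial core pairs. -/
def ExtendedInv {A Z : ℕ} (d : ℕ) (X : ℕ → ℕ → ℝ) (r₀ : ℕ → Fin A × Fin Z) (k : ℕ) (s : State) :
    Prop :=
  ∃ (n : ℕ) (r : ℕ → Fin A × Fin Z) (w : Fin A × Fin Z → ℝ), d ≤ n ∧ (∀ j < d, r j = r₀ j) ∧
    DesignInv d X k n r w s ∧ LeverageInv A Z d X s

theorem designAll_spec {A Z M d : ℕ} (hA : 1 ≤ A) (hZ : 1 ≤ Z) {B : ℕ → ℕ → ℝ}
    {r : ℕ → Fin A × Fin Z} {y : ℕ → Fin A × Fin Z → ℝ} {s : State} (h : PivotInv M B M d r y s) :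
    Spec designAll s (designSteps d * (d * (A * Z * 67 + 77) + A * Z * 47 + 107) +
        (d * (A * Z * 36 + 34) + A * Z * 34 + 47)) (fun s' =>
      (∃ k, ExtendedInv d (s.realArr 1) r k s') ∧ ¬ improvable.holds s' ∧ s'.nat 0 = s'.nat 9) := by
  refine (Spec.seq (copyBasis_spec h.nat3 h.nat4) (T' := designSteps d *
    (d * (A * Z * 67 + 77) + A * Z * 47 + 107) + (d * (A * Z * 22 + 17) + A * Z * 34 + 41)) ?_).mono
    (by ring_nf; omega) fun _ h => h
  rintro s1 ⟨hF1, hV1⟩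
  refine (Spec.seq (Spec.setNat (Q := fun t => t = s1.setNat 9 d)
    (by simp [NExpr.eval, hF1.nat 4, h.nat4])) (T' := designSteps d *
    (d * (A * Z * 67 + 77) + A * Z * 47 + 107) + (d * (A * Z * 22 + 17) + A * Z * 34 + 39)) ?_).mono
    (by simp only [NExpr.cost]; omega) fun _ h => h
  rintro _ rfl
  refine (Spec.seq (Spec.setReal (Q := fun t => t = (s1.setNat 9 d).setReal 2 d)
    (by simp [RExpr.eval, NExpr.eval, hF1.nat 4, h.nat4])) (T' := designSteps d *
    (d * (A * Z * 67 + 77) + A * Z * 47 + 107) + (d * (A * Z * 22 + 17) + A * Z * 34 + 36)) ?_).mono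
    (by simp only [RExpr.cost, NExpr.cost]; omega) fun _ h => h
  rintro _ rfl
  -- Duality gives the pivot rows unit coordinate vectors. The initial Gram matrix is therefore the
  -- identity, and the copied basis already solves the linear systems.
  have hunit : ∀ j : Fin d, rowVec d (s.realArr 1) (r j) = Pi.single j 1 := by
    intro j
    funext k
    have := h.basis.dual k k.2 j j.2
    simp only [rowVec, Pi.single_apply]
    rw [this]
    simp [Fin.ext_iff]
  have hgram : designGram (rowVec d (s.realArr 1)) (unitDesign fun j : Fin d => r j) = 1 :=
    designGram_unitDesign _ _ hunit
  obtain ⟨C, hC, hCx⟩ := h.basis.exists_unimodular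
  have h0 : DesignInv d (s.realArr 1) 0 d r (unitDesign fun j : Fin d => r j)
      ((s1.setNat 9 d).setReal 2 d) := by
    refine ⟨by simp [hF1.nat 3, h.nat3], by simp [hF1.nat 4, h.nat4], by simp,
      by simp [hF1.realArr 1], by simp [sum_unitDesign], unitDesign_nonneg _, ?_,
      h.core.congr (by simp [hF1.natArr]), fun i hi j hj hij => h.basis.pivot_injOn hi hj hij,
      by rw [hgram]; exact PosDef.one, fun q => ?_, le_rfl, fun _ => rfl,
      by rw [sum_unitDesign], ?_⟩
    · intro q hq
      obtain ⟨j, rfl⟩ := exists_of_unitDesign_ne_zero hq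
      exact ⟨j, j.2, rfl⟩
    · rw [hgram, one_mulVec]
      funext j
      exact hV1 _ (rowIndex_lt q) j j.2
    · intro hd
      rw [Nat.cast_zero, zero_add]
      exact stepBound_mono hd (designGap_unitDesign_le hd C hC _ hCx _ hunit)
  refine (Spec.seq (h0.leverages hA hZ) (T' := designSteps d *
    (d * (A * Z * 67 + 77) + A * Z * 47 + 107) + 12) ?_).mono (by omega) fun _ h => h
  rintro s2 ⟨h2, hL2⟩
  refine (Spec.seq (Spec.loop (T := d * (A * Z * 67 + 77) + A * Z * 47 + 97) (N := designSteps d)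
    (ExtendedInv d (s.realArr 1) r) ?_ ?_ ?_) (T' := 2) ?_).mono ?_ fun _ h => h
  · exact ⟨d, r, _, le_rfl, fun _ _ => rfl, h2, hL2⟩
  · rintro k t ⟨n, r', w, hdn, hr', hD, hL⟩ hb
    obtain ⟨hd, -⟩ := hD.pos_of_improvable hL hb
    have hgap := designGap_nonneg _ (bddAbove_designPotentials hd C hC _ hCx) hD.nonneg
      ((Nat.cast_pos.2 hd).trans_le hD.le_weight) hD.pos
    -- The remaining `stepBound` is nonnegative, so the steps already made are bounded by the
    -- initial one.
    have hk : (k : ℝ) ≤ stepBound d (d * Real.log d) := by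
      have := stepBound_nonneg d hd hgap
      have h' := hD.gap hd
      change _ ≤ stepBound d (designGap (rowVec d (s.realArr 1)) w) at this
      linarith
    exact Nat.lt_succ_of_le (Nat.le_floor hk)
  · rintro k t ⟨n, r', w, hdn, hr', hD, hL⟩ hb
    refine (Spec.seq (hD.improve hL hb) (T' := d * (A * Z * 22 + 17) + A * Z * 34 + 24) ?_).mono
      (by ring_nf; omega) fun _ h => h
    rintro t1 ⟨n', r'', w', hnn', hr'', hD'⟩
    refine (hD'.leverages hA hZ).mono le_rfl ?_
    rintro t2 ⟨hD2, hL2⟩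
    exact ⟨n', r'', w', hdn.trans hnn',
      fun j hj => (hr'' j (hj.trans_le hdn)).trans (hr' j hj), hD2, hL2⟩
  · rintro t ⟨⟨k, n, r', w, hdn, hr', hD, hL⟩, hb⟩
    refine Spec.setNat ⟨⟨k, n, r', w, hdn, hr', ⟨by simp [hD.nat3], by simp [hD.nat4],
      by simp [hD.nat9], hD.basis, hD.weight, hD.nonneg, hD.support, hD.core.congr rfl, hD.injOn,
      hD.pos, hD.sol, hD.card_le, hD.steps, hD.le_weight, hD.gap⟩, hL.le, hL.nonneg, ?_⟩, ?_, ?_⟩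
    · simpa using hL.attained
    · simpa [improvable, BExpr.holds, RExpr.eval, NExpr.eval] using hb
    · simp [NExpr.eval]
  · simp only [BExpr.cost, RExpr.cost, NExpr.cost, improvable]
    ring_nf
    omega

end RealRAM

/-! ### Assembly: running time, number of core pairs, error bound and the matrix `T`. -/

namespace RealRAM

open Matrix

/-- The algorithm. -/
def coreProgram : Prog := .seq tabulate (.seq pivotAll designAll)

theorem inputState_realArr {A Z M : ℕ} (b : Fin M → Fin A × Fin Z → ℝ) (q : Fin A × Fin Z)
    {m : ℕ} (hm : m < M) : (inputState A Z M b).realArr 0 (rowIndex q) m = b ⟨m, hm⟩ q := by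
  simp only [inputState]
  rw [dif_pos ⟨trivial, rowIndex_lt q, hm⟩]
  congr 1
  rw [Equiv.symm_apply_eq]
  apply Fin.ext
  simp only [finProdFinEquiv_apply_val, rowIndex]
  ring

theorem span_inputState {A Z M : ℕ} (b : Fin M → Fin A × Fin Z → ℝ) :
    Submodule.span ℝ ((fun k (q : Fin A × Fin Z) =>
      (inputState A Z M b).realArr 0 (rowIndex q) k) '' Set.Iio M) =
      Submodule.span ℝ (Set.range b) := by
  congr 1
  ext u
  constructor
  · rintro ⟨m, hm, rfl⟩
    exact ⟨⟨m, hm⟩, funext fun q => (inputState_realArr b q hm).symm⟩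
  · rintro ⟨m, rfl⟩
    exact ⟨m, m.2, funext fun q => inputState_realArr b q m.2⟩

theorem designSteps_le {d M : ℕ} (hd : d ≤ M) (hM : 1 ≤ M) :
    (designSteps d : ℝ) ≤ 4 * M * (1 + Real.log M) := by
  have hM' : (1 : ℝ) ≤ M := by exact_mod_cast hM
  have hlog := Real.log_nonneg hM'
  have h1 : (1 : ℝ) ≤ M * (1 + Real.log M) := by nlinarith
  rcases Nat.eq_zero_or_pos d with rfl | hd0
  · have : designSteps 0 = 1 := by simp [designSteps, stepBound]
    rw [this]
    push_cast
    linarith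
  · have hd' : (1 : ℝ) ≤ d := by exact_mod_cast hd0
    have hdM : (d : ℝ) ≤ M := by exact_mod_cast hd
    have hlogd := Real.log_nonneg hd'
    have hnn : 0 ≤ stepBound d (d * Real.log d) := stepBound_nonneg d hd0 (by positivity)
    have h2 := stepBound_le_mul_log hd0
    have h3 : (3 : ℝ) * d * (1 + Real.log d) ≤ 3 * M * (1 + Real.log M) := by gcongr
    have h4 := Nat.floor_le hnn
    rw [designSteps]
    push_cast
    linarith

/-- Elimination costs `O(AZM²)`; the iteration makes `O(M (1 + log M))` steps of cost `O(AZM)`,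
which contributes the single logarithm. -/
theorem coreProgram_cost_le {A Z M d t : ℕ} (hA : 1 ≤ A) (hZ : 1 ≤ Z) (hM : 1 ≤ M) (hd : d ≤ M)
    (ht : t ≤ (A * Z * 40 + 20) + ((M * (M * (A * Z * 40 + 80) + A * Z * 60 + 108) + 6) +
      (designSteps d * (d * (A * Z * 67 + 77) + A * Z * 47 + 107) +
        (d * (A * Z * 36 + 34) + A * Z * 34 + 47)))) :
    (t : ℝ) ≤ (2000 : ℕ) * (Z * A * (M : ℝ) ^ 2) *
      (1 + Real.log (Z * A * (M : ℝ) ^ 2)) ^ 1 := by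
  have hK : 1 ≤ A * Z := Nat.mul_pos hA hZ
  set K := A * Z with hKdef
  have hMK : 1 ≤ M * K := Nat.mul_pos hM hK
  have h1 : d * (K * 67 + 77) + K * 47 + 107 ≤ 298 * (M * K) := by
    have : d * (K * 67 + 77) ≤ M * (K * 67 + 77) := Nat.mul_le_mul_right _ hd
    nlinarith
  have h2 : d * (K * 36 + 34) + K * 34 + 47 ≤ 160 * (M * (M * K)) := by
    have h3 : d * (K * 36 + 34) ≤ M * (K * 36 + 34) := Nat.mul_le_mul_right _ hd
    have h4 : M * K ≤ M * (M * K) := Nat.mul_le_mul_left _ (Nat.le_mul_of_pos_left _ hM)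
    nlinarith
  have h3 : (K * 40 + 20) + (M * (M * (K * 40 + 80) + K * 60 + 108) + 6) ≤
      400 * (M * (M * K)) := by
    have h4 : M * K ≤ M * (M * K) := Nat.mul_le_mul_left _ (Nat.le_mul_of_pos_left _ hM)
    have h5 : M * M ≤ M * (M * K) := Nat.mul_le_mul_left _ (Nat.le_mul_of_pos_right _ hK)
    nlinarith
  have h4 : t ≤ designSteps d * (298 * (M * K)) + 560 * (M * (M * K)) := by
    have := Nat.mul_le_mul_left (designSteps d) h1
    omega
  have hM' : (1 : ℝ) ≤ M := by exact_mod_cast hM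
  have hK' : (1 : ℝ) ≤ K := by exact_mod_cast hK
  have h5 : (t : ℝ) ≤ designSteps d * (298 * (M * K)) + 560 * (M * (M * K)) := by exact_mod_cast h4
  have h6 := designSteps_le hd hM
  have hZA : (Z : ℝ) * A = K := by rw [hKdef]; push_cast; ring
  have h7 : Real.log M ≤ Real.log (K * (M : ℝ) ^ 2) :=
    Real.log_le_log (by positivity) (by nlinarith)
  have hlog := Real.log_nonneg hM'
  rw [hZA, pow_one]
  set l := Real.log (K * (M : ℝ) ^ 2)
  calc (t : ℝ) ≤ designSteps d * (298 * (M * K)) + 560 * (M * (M * K)) := h5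
    _ ≤ (4 * M * (1 + Real.log M)) * (298 * (M * K)) + 560 * (M * (M * K)) := by gcongr
    _ ≤ (4 * M * (1 + l)) * (298 * (M * K)) + 560 * (M * (M * K)) * (1 + l) :=
        add_le_add (by gcongr) (le_mul_of_one_le_right (by positivity) (by linarith))
    _ = 1752 * (K * (M : ℝ) ^ 2) * (1 + l) := by ring
    _ ≤ _ := by
        push_cast
        gcongr
        · linarith
        · norm_num

theorem DesignInv.card_le_log {A Z M d k n : ℕ} (hM : 1 ≤ M) (hdM : d ≤ M)
    {r r₀ : ℕ → Fin A × Fin Z} {y : ℕ → Fin A × Fin Z → ℝ} {w : Fin A × Fin Z → ℝ}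
    {S : Submodule ℝ (Fin A × Fin Z → ℝ)} {X : ℕ → ℕ → ℝ} {s : State}
    (hX : PivotBasis d S r₀ (fun j q => X (rowIndex q) j) y) (h : DesignInv d X k n r w s) :
    (n : ℝ) ≤ 4 * M * Real.log (Real.log M) + 16 := by
  have hn : (n : ℝ) ≤ d + k := by exact_mod_cast h.card_le
  rcases Nat.eq_zero_or_pos d with rfl | hd
  · rw [h.steps rfl] at hn
    have h1 := natCast_mul_log_log_ge hM
    have h2 : (0 : ℝ) ≤ M := Nat.cast_nonneg M
    push_cast at hn
    linarith
  · obtain ⟨C, hC, hCx⟩ := hX.exists_unimodular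
    have hgap := designGap_nonneg _ (bddAbove_designPotentials hd C hC _ hCx) h.nonneg
      ((Nat.cast_pos.2 hd).trans_le h.le_weight) h.pos
    have h1 := stepBound_nonneg d hd hgap
    have h2 := h.gap hd
    change 0 ≤ stepBound d (designGap (rowVec d X) w) at h1
    linarith [add_stepBound_le hd hdM]

/-- On exit the maximal leverage times the total weight is at most `8d ≤ 8M = (2√(2M))²`. -/
theorem DesignInv.abs_le {A Z M d k n : ℕ} (hdM : d ≤ M)
    {r r₀ : ℕ → Fin A × Fin Z} {y : ℕ → Fin A × Fin Z → ℝ} {w : Fin A × Fin Z → ℝ}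
    {S : Submodule ℝ (Fin A × Fin Z → ℝ)} {X : ℕ → ℕ → ℝ} {s : State}
    (hX : PivotBasis d S r₀ (fun j q => X (rowIndex q) j) y) (h : DesignInv d X k n r w s)
    (hL : LeverageInv A Z d X s) (hb : ¬ improvable.holds s) {u : Fin A × Fin Z → ℝ} (hu : u ∈ S)
    {b : ℝ} (hb0 : 0 ≤ b) (hub : ∀ j < n, |u (r j)| ≤ b) (q : Fin A × Fin Z) :
    |u q| ≤ 2 * Real.sqrt (2 * M) * b := by
  rw [h.improvable_iff, not_lt] at hb
  have hdM' : (d : ℝ) ≤ M := by exact_mod_cast hdM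
  have hθ : ∀ q, (fun j : Fin d => u (r₀ j)) ⬝ᵥ rowVec d X q = u q := by
    intro q
    have := congrFun (hX.eq_sum hu) q
    rw [this, Finset.sum_apply]
    exact Fin.sum_univ_eq_sum_range (fun j => u (r₀ j) * X (rowIndex q) j) d
  have hsq := dotProduct_sq_le_of_abs_le (rowVec d X) (rowVec d (s.realArr 2)) h.nonneg h.sol
    hL.nonneg hL.le (fun j : Fin d => u (r₀ j)) (B := b) (fun q' hq' => by
      obtain ⟨j, hj, rfl⟩ := h.support q' hq'
      rw [hθ]
      exact hub j hj) q
  rw [hθ] at hsq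
  refine abs_le_of_sq_le_sq (hsq.trans ?_) (by positivity)
  rw [mul_pow, mul_pow, Real.sq_sqrt (by positivity)]
  refine mul_le_mul_of_nonneg_right ?_ (sq_nonneg b)
  linarith

/-- The first `d` core pairs are the pivots, where interpolation applies; the remaining columns are
zero. -/
theorem pivotBasis_mulVec {A Z d n : ℕ} {r r₀ : ℕ → Fin A × Fin Z}
    {y : ℕ → Fin A × Fin Z → ℝ} {S : Submodule ℝ (Fin A × Fin Z → ℝ)} {X : ℕ → ℕ → ℝ}
    (hX : PivotBasis d S r₀ (fun j q => X (rowIndex q) j) y) (hX0 : ∀ i j, d ≤ j → X i j = 0)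
    (hdn : d ≤ n) (hr : ∀ j < d, r j = r₀ j) {u : Fin A × Fin Z → ℝ} (hu : u ∈ S) :
    (Matrix.of fun (q : Fin A × Fin Z) (j : Fin n) => X (rowIndex q) j) *ᵥ
      (fun j => u (r j)) = u := by
  funext q
  have := congrFun (hX.eq_sum hu) q
  rw [this, Finset.sum_apply]
  calc _ = ∑ j ∈ Finset.range n, X (rowIndex q) j * u (r j) :=
        Fin.sum_univ_eq_sum_range (fun j => X (rowIndex q) j * u (r j)) n
    _ = ∑ j ∈ Finset.range d, X (rowIndex q) j * u (r j) := by
        refine (Finset.sum_subset (Finset.range_subset_range.2 hdn) fun j _ hj => ?_).symm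
        rw [hX0 _ _ (not_lt.1 fun h => hj (Finset.mem_range.2 h)), zero_mul]
    _ = _ := Finset.sum_congr rfl fun j hj => by
        rw [hr j (Finset.mem_range.1 hj), Pi.smul_apply, smul_eq_mul, mul_comm]

end RealRAM

theorem iSup_sum_abs_le {A Z : ℕ} (hA : 1 ≤ A) {u : Fin A × Fin Z → ℝ} {c b : ℝ}
    (hu : ∀ q, |u q| ≤ c * b) :
    (⨆ a : Fin A, ∑ z : Fin Z, |u (a, z)|) ≤ Z * c * b := by
  have : Nonempty (Fin A) := ⟨⟨0, hA⟩⟩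
  refine ciSup_le fun a => ?_
  calc ∑ z : Fin Z, |u (a, z)| ≤ ∑ _z : Fin Z, c * b := Finset.sum_le_sum fun z _ => hu _
    _ = _ := by simp [mul_assoc]

theorem corollary1 :
    ∃ (p : RealRAM.Prog) (C c : ℕ),
      ∀ (A Z M : ℕ), 1 ≤ A → 1 ≤ Z → 1 ≤ M →
      ∀ (μ b : Fin M → Fin A × Fin Z → ℝ) (U : Submodule ℝ (Fin A × Fin Z → ℝ)),
        U = Submodule.span ℝ (Set.range μ) →
        U = Submodule.span ℝ (Set.range b) →
        ∃ (s : RealRAM.State) (t n : ℕ) (core : Fin n → Fin A × Fin Z)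
          (T : Matrix (Fin A × Fin Z) (Fin n) ℝ),
          RealRAM.Runs p (inputState A Z M b) s t ∧
          (t : ℝ) ≤ C * (Z * A * (M : ℝ) ^ 2) * (1 + Real.log (Z * A * (M : ℝ) ^ 2)) ^ c ∧
          HasOutput s core T ∧
          Function.Injective core ∧
          (n : ℝ) ≤ 4 * M * Real.log (Real.log M) + 16 ∧
          (∀ (m : Fin M), ∀ μhat ∈ U,
            (⨆ a : Fin A, ∑ z : Fin Z, |μ m (a, z) - μhat (a, z)|) ≤
              2 * Z * Real.sqrt (2 * M) * ⨆ j : Fin n, |μ m (core j) - μhat (core j)|) ∧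
          ∀ μhat ∈ U, T.mulVec (fun j => μhat (core j)) = μhat := by
  refine ⟨RealRAM.coreProgram, 2000, 1, fun A Z M hA hZ hM μ b U hμ hb => ?_⟩
  obtain ⟨s₁, t₁, hrun₁, ht₁, h3, hn₁, -, hra₁, hna₁, htab⟩ :=
    RealRAM.tabulate_spec (A := A) hZ (inputState A Z M b) rfl rfl rfl rfl
  obtain ⟨s₂, t₂, hrun₂, ht₂, d, r₀, y, h₂⟩ := RealRAM.pivotAll_spec hA hZ (M := M) (s := s₁)
    (by rw [hn₁ 1 (by decide) (by decide) (by decide) (by decide)]; rfl)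
    (by rw [hn₁ 2 (by decide) (by decide) (by decide) (by decide)]; rfl) h3
    (by rw [hn₁ 4 (by decide) (by decide) (by decide) (by decide)]; rfl) htab
    (fun i => by rw [hna₁ 2 (by decide)]; rfl) (fun i j => by rw [hra₁]; simp [inputState])
  obtain ⟨s, t₃, hrun₃, ht₃, ⟨k, n, r, w, hdn, hr, hD, hL⟩, hexit, h0⟩ :=
    RealRAM.designAll_spec hA hZ h₂
  have hX := h₂.basis
  rw [hra₁, RealRAM.span_inputState, ← hb] at hX
  refine ⟨s, t₁ + (t₂ + t₃), n, fun j => r j,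
    Matrix.of fun q j => s₂.realArr 1 (RealRAM.rowIndex q) j, .seq hrun₁ (.seq hrun₂ hrun₃),
    RealRAM.coreProgram_cost_le hA hZ hM h₂.le (by omega),
    ⟨h0.trans hD.nat9, fun j => hD.core.core j j.2, fun a z j => by rw [hD.basis]; rfl⟩,
    fun i j hij => Fin.ext (hD.injOn i i.2 j j.2 hij), hD.card_le_log hM h₂.le hX,
    fun m μhat hμhat => ?_, fun μhat hμhat => RealRAM.pivotBasis_mulVec hX h₂.zero hdn hr hμhat⟩
  have hu : μ m - μhat ∈ U :=
    U.sub_mem (hμ ▸ Submodule.subset_span (Set.mem_range_self m)) hμhat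
  -- The bound on the core pairs is the supremum itself; without core pairs it is `0` by the
  -- convention for an empty real supremum.
  have hbound := hD.abs_le h₂.le hX hL hexit hu
    (Real.iSup_nonneg fun j : Fin n => abs_nonneg ((μ m - μhat) (r j)))
    fun j hj => le_ciSup (f := fun j : Fin n => |(μ m - μhat) (r j)|)
      (Set.finite_range _).bddAbove ⟨j, hj⟩
  refine (iSup_sum_abs_le hA hbound).trans_eq ?_
  simp only [Pi.sub_apply]
  ring
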